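/- **Setting.** Fix $r>0$, $\lambda>0$, $z$, $s$ with $g:=\lambda z>s>0$, and $\bar c>(\tfrac{\lambda}{r}+1)(g-s)$. Agents arrive sequentially with i.i.d. private reporting costs $c\in[0,\bar c]$ drawn from a distribution $H$ whose density $h$ is smooth and positive on $(0,\bar c)$, with positive (finite) limits at $0^+$ and $\bar c^-$, and such that $x\mapsto x+H(x)/h(x)$ has positive derivative on $(0,\bar c)$. Write $\mathbb E$ for expectation in $c\sim H$. A safe product gives flow utility $s$; a risky product gives, in the good state, a lump sum $z$ at rate $\lambda$, and nothing in the bad state; $\alpha\in(0,1)$ is the common belief that the state is good. A mechanism consists of measurable $p,q,t$: an agent declaring cost $\tilde c$ at belief $\alpha$ gets the risky product with probability $p(\alpha,\tilde c)\in[0,1]$, must then report his utility with probability $q(\alpha,\tilde c)\in[0,1]$, and pays $t(\alpha,\tilde c)$; with true cost $c$ his flow utility is $$U(c,\tilde c,\alpha)=-t(\alpha,\tilde c)+p(\alpha,\tilde c)\,[\alpha z\lambda-q(\alpha,\tilde c)c]+(1-p(\alpha,\tilde c))s .$$ The mechanism is incentive compatible if $c\in\arg\max_{\tilde c\in[0,\bar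 c]}U(c,\tilde c,\alpha)$ for all $\alpha\in(0,1)$ and $c\in[0,\bar c]$. Let $x(\alpha)=\mathbb E[p(\alpha,c)q(\alpha,c)]$. From an initial belief $\alpha_0\in(0,1)$, a (continuous) no-news belief path generated by the mechanism is a solution of $$\alpha_\tau=\frac{\alpha_0e^{-\lambda X_\tau}}{S_\tau},\qquad X_\tau=\int_0^\tau x(\alpha_u)\,du,\qquad S_\tau=\alpha_0e^{-\lambda X_\tau}+1-\alpha_0\qquad(\tau\ge 0),$$ and its welfare along such a path is the expected discounted social surplus (under truthful declaration; continuation value $\lambda z/r$ once good news is reported) $$\int_0^\infty e^{-r\tau}S_\tau\Big(\mathbb E\big[p\lambda z\alpha_\tau-pqc+(1-p)s\big]+\lambda\alpha_\tau x(\alpha_\tau)\tfrac{\lambda z}{r}\Big)d\tau,$$ where $p,q$ are evaluated at $(\alpha_\tau,c)$. Let $W(\alpha_0)$ be the supremum of welfare over all mechanisms and their belief paths from $\alpha_0$. A mechanism is optimal if from every $\alpha_0\in(0,1)$ it generates a belief path, and every belief path that it generates from $\alpha_0$ attains the maximum of welfare. Put $$B(\alpha)=\frac{\alpha\lambda^2z}{r}+(\alpha^2-\alpha)\lambda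 W'(\alpha)-\lambda\alpha W(\alpha),\qquad C_1(\alpha)=B(\alpha)+\lambda z\alpha-s,\qquad C_2(\alpha)=B(\alpha).$$ **Proposition.** There exist an incentive-compatible optimal mechanism $(p,q,t)$ and cutoffs $0<\bar\alpha_{SA}^{PC}<\bar\alpha_{PC}^{FC}<\bar\alpha_{FC}^{NB}<1$ such that $W$ is differentiable on $(0,1)$ and satisfies there $$[r+\lambda\alpha\,\mathbb E(pq)]W=\lambda\alpha z\,\mathbb E(p)+[1-\mathbb E(p)]s-\mathbb E(pqc)+\tfrac{\lambda^2z\alpha}{r}\mathbb E(pq)+(\alpha^2-\alpha)\lambda W'\,\mathbb E(pq),$$ and, for all $c\in[0,\bar c]$: * if $0<\alpha<\bar\alpha_{SA}^{PC}$, then $p=q=0$ (Safe Arm); * if $\bar\alpha_{SA}^{PC}<\alpha<\bar\alpha_{PC}^{FC}$, then $0<C_1(\alpha)<\bar c$, $q=1$, and $p=1$ if $c<C_1(\alpha)$, $p=0$ otherwise (Partial Coverage); * if $\bar\alpha_{PC}^{FC}<\alpha<\bar\alpha_{FC}^{NB}$, then $0<C_2(\alpha)<\bar c$, $p=1$, and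 $q=1$ if $c<C_2(\alpha)$, $q=0$ otherwise (Full Coverage); * if $\bar\alpha_{FC}^{NB}<\alpha<1$, then $p=1$ and $q=0$ (Non Bonus). -/

import Mathlib

open Set Filter Topology MeasureTheory

noncomputable section

/-- Primitives of the exponential-bandit market with costly reporting, with the standing
assumptions.  `lam` is the arrival rate of the lump sum `z` in the good state, `s` the flow utility
of the safe product, `r` the discount rate, and `h` the density of the reporting cost on
`[0, cbar]` (only its values on the open interval matter). -/
structure Market where
  r : ℝ
  lam : ℝ
  z : ℝ
  s : ℝ
  cbar : ℝ
  h : ℝ → ℝ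
  r_pos : 0 < r
  lam_pos : 0 < lam
  s_pos : 0 < s
  s_lt : s < lam * z
  h_smooth : ContDiffOn ℝ (⊤ : ℕ∞) h (Ioo 0 cbar)
  h_pos : ∀ c ∈ Ioo 0 cbar, 0 < h c
  h_total : ∫ c in (0 : ℝ)..cbar, h c = 1
  h_left : ∃ l : ℝ, 0 < l ∧ Tendsto h (𝓝[>] 0) (𝓝 l)
  h_right : ∃ l : ℝ, 0 < l ∧ Tendsto h (𝓝[<] cbar) (𝓝 l)
  /-- The virtual value `x + H x / h x` has positive derivative
  (it is smooth since `h` is smooth and positive). -/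
  virtual_deriv_pos : ∀ x ∈ Ioo 0 cbar,
    0 < deriv (fun y : ℝ => y + (∫ c in (0 : ℝ)..y, h c) / h y) x
  cbar_large : (lam / r + 1) * (lam * z - s) < cbar

namespace Market

/-- Expectation with respect to the reporting cost. -/
def expect (M : Market) (f : ℝ → ℝ) : ℝ :=
  ∫ c in (0 : ℝ)..M.cbar, f c * M.h c

/-- A direct mechanism of the planner.  At belief `α` and reported cost `c`, the risky product is
allocated with probability `p α c`; given this allocation, the agent is obliged to report his
utility with probability `q α c`; and he pays the transfer `t α c`. -/
structure Mechanism (M : Market) where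
  p : ℝ → ℝ → ℝ
  q : ℝ → ℝ → ℝ
  t : ℝ → ℝ → ℝ
  p_measurable : Measurable (Function.uncurry p)
  q_measurable : Measurable (Function.uncurry q)
  t_measurable : Measurable (Function.uncurry t)
  p_mem : ∀ α ∈ Ioo (0 : ℝ) 1, ∀ c ∈ Icc 0 M.cbar, p α c ∈ Icc (0 : ℝ) 1
  q_mem : ∀ α ∈ Ioo (0 : ℝ) 1, ∀ c ∈ Icc 0 M.cbar, q α c ∈ Icc (0 : ℝ) 1

variable {M : Market}

namespace Mechanism

/-- Flow utility of an agent with true cost `c` who declares the cost `c'` at belief `α`. -/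
def agentUtility (m : M.Mechanism) (c c' α : ℝ) : ℝ :=
  -m.t α c' + m.p α c' * (α * M.z * M.lam - m.q α c' * c) + (1 - m.p α c') * M.s

/-- Truthful declaration of the cost is optimal for every agent, at every belief. -/
def IncentiveCompatible (m : M.Mechanism) : Prop :=
  ∀ α ∈ Ioo (0 : ℝ) 1, ∀ c ∈ Icc 0 M.cbar, ∀ c' ∈ Icc 0 M.cbar,
    m.agentUtility c c' α ≤ m.agentUtility c c α

/-- Probability that the current agent consumes the risky product and reports, `E(pq)`. -/
def reportProb (m : M.Mechanism) (α : ℝ) : ℝ :=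
  M.expect fun c => m.p α c * m.q α c

/-- Expected flow of social surplus at belief `α` (transfers cancel). -/
def flowSurplus (m : M.Mechanism) (α : ℝ) : ℝ :=
  M.expect fun c =>
    m.p α c * (M.lam * M.z * α) - m.p α c * m.q α c * c + (1 - m.p α c) * M.s

/-- Amount of reported experimentation up to time `τ`, along the belief path `a`. -/
def experience (m : M.Mechanism) (a : ℝ → ℝ) (τ : ℝ) : ℝ :=
  ∫ u in (0 : ℝ)..τ, m.reportProb (a u)

/-- Probability, at initial belief `α₀`, that no good news is reported up to time `τ`:
in the good state reported good news arrives at rate `lam * reportProb`, in the bad state never. -/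
def noNewsProb (m : M.Mechanism) (α₀ : ℝ) (a : ℝ → ℝ) (τ : ℝ) : ℝ :=
  α₀ * Real.exp (-(M.lam * m.experience a τ)) + (1 - α₀)

/-- `a` is the path of the common belief, as long as no good news is reported, that starts at `α₀`
and is generated through Bayes' rule by the mechanism `m`. -/
structure IsBeliefPath (m : M.Mechanism) (α₀ : ℝ) (a : ℝ → ℝ) : Prop where
  continuousOn : ContinuousOn a (Ici 0)
  bayes : ∀ τ, 0 ≤ τ →
    a τ = α₀ * Real.exp (-(M.lam * m.experience a τ)) / m.noNewsProb α₀ a τ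

/-- Expected discounted social surplus of the mechanism `m` from the initial belief `α₀`, along the
no-news belief path `a`.  Reported good news arrives at rate `lam * α * reportProb`; the belief then
jumps to `1`, where the continuation value is `lam * z / r`. -/
def welfare (m : M.Mechanism) (α₀ : ℝ) (a : ℝ → ℝ) : ℝ :=
  ∫ τ in Ioi (0 : ℝ), Real.exp (-(M.r * τ)) * m.noNewsProb α₀ a τ *
    (m.flowSurplus (a τ) + M.lam * a τ * m.reportProb (a τ) * (M.lam * M.z / M.r))

end Mechanism

/-- The levels of welfare that mechanisms can generate from the initial belief `α₀`. -/
def attainable (M : Market) (α₀ : ℝ) : Set ℝ :=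
  {v | ∃ (m : M.Mechanism) (a : ℝ → ℝ), m.IsBeliefPath α₀ a ∧ v = m.welfare α₀ a}

/-- A mechanism is optimal if from every initial belief it generates a belief path, and any path it
generates yields the greatest welfare among all mechanisms. -/
def Mechanism.IsOptimal (m : M.Mechanism) : Prop :=
  ∀ α₀ ∈ Ioo (0 : ℝ) 1, (∃ a, m.IsBeliefPath α₀ a) ∧
    ∀ a, m.IsBeliefPath α₀ a → IsGreatest (M.attainable α₀) (m.welfare α₀ a)

/-- The planner's value function. -/
def W (M : Market) (α : ℝ) : ℝ := sSup (M.attainable α)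

/-- The net social value of one more report. -/
def B (M : Market) (α : ℝ) : ℝ :=
  α * M.lam ^ 2 * M.z / M.r + (α ^ 2 - α) * M.lam * deriv M.W α - M.lam * α * M.W α

/-- The cost cutoff under Partial Coverage. -/
def C₁ (M : Market) (α : ℝ) : ℝ := M.B α + M.lam * M.z * α - M.s

/-- The cost cutoff under Full Coverage. -/
def C₂ (M : Market) (α : ℝ) : ℝ := M.B α

end Market

end

/-! Write `g = lam * z` and let `b` be the net value of one more report at belief `α`. Taking the
best `p`, `q` separately for each cost, the flow surplus plus `b` times the report probability is at
most `max s (g α) + E (b - (s - g α)⁺ - c)⁺`. The bound is attained by collecting a report exactly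
from costs below `b - (s - g α)⁺` and giving everybody else the myopically better product. This
cutoff is `C₁` where `g α < s` and `C₂` where `g α > s`, so the two coverage regimes meet at `s /
g`.

The planner's equation thus reads `r W = max s (g α) + excess (b - (s - g α)⁺)`, with `W'` hidden in
`b`. Inverting `excess` on nonnegative numbers by `Φ` turns it into the explicit equation `lam α (1
- α) W' = valueDrift`. It is not Lipschitz, as `Φ` rises at least like a square root at `0`, but its
right-hand side is nonincreasing in the value. This monotonicity makes solutions of regularized
equations a Cauchy sequence (`exists_solution_of_antitone`).

The solution leaves the safe value `s / r` at the belief `a₀` where a report just pays for the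
myopic loss, and barrier arguments keep it between `max s (g α) / r` and `g / r`. The square-root
growth of `Φ` forces it to meet the line `g α / r` at some `a₁ < 1`
(`IsValueSolution.exists_le_risky`). Continuing it by the safe value on the left and by the line on
the right gives a `C¹` function `w` (`exists_isBellmanSolution`).

Verification (`IsBeliefPath.welfare_le`) differentiates the discounted no-news probability times `w`
along a belief path: `w` bounds the welfare of every mechanism, and a mechanism attaining the
pointwise maximum reaches it on all its paths. Hence `W = w` on `(0, 1)`. The cutoff mechanism is a
posted reward for reporting, so it is incentive compatible. It generates belief paths by separation
of variables, since its field need not be Lipschitz (`exists_isBeliefPath_cutoffMechanism`). -/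

/-! ### Scalar differential equations without Lipschitz continuity -/

/-- A continuous function that becomes negative has a last nonnegative point before. -/
lemma exists_last_nonneg {f : ℝ → ℝ} {a t : ℝ} (hat : a ≤ t) (hc : ContinuousOn f (Icc a t))
    (h0 : 0 ≤ f a) (ht : f t < 0) :
    ∃ y ∈ Ico a t, 0 ≤ f y ∧ ∀ u ∈ Ioc y t, f u < 0 := by
  have hcl : IsClosed (Icc a t ∩ f ⁻¹' Ici 0) :=
    hc.preimage_isClosed_of_isClosed isClosed_Icc isClosed_Ici
  have hK : IsCompact (Icc a t ∩ f ⁻¹' Ici 0) :=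
    isCompact_Icc.of_isClosed_subset hcl inter_subset_left
  have hne : (Icc a t ∩ f ⁻¹' Ici 0).Nonempty := ⟨a, ⟨le_rfl, hat⟩, h0⟩
  obtain ⟨y, ⟨hy, hfy⟩, hmax⟩ := hK.exists_isGreatest hne
  have hyt : y ≠ t := by
    rintro rfl
    exact absurd hfy (not_le.2 ht)
  refine ⟨y, ⟨hy.1, lt_of_le_of_ne hy.2 hyt⟩, hfy, fun u hu => ?_⟩
  by_contra hcon
  exact absurd (hmax ⟨⟨hy.1.trans hu.1.le, hu.2⟩, not_lt.1 hcon⟩) (not_le.2 hu.1)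

/-- Barrier principle: a function that does not decrease where it is negative stays nonnegative. -/
lemma nonneg_of_deriv_nonneg_of_neg {f f' : ℝ → ℝ} {a b : ℝ} (hc : ContinuousOn f (Icc a b))
    (hd : ∀ t ∈ Ioo a b, HasDerivAt f (f' t) t) (h0 : 0 ≤ f a)
    (h : ∀ t ∈ Ioo a b, f t < 0 → 0 ≤ f' t) : ∀ t ∈ Icc a b, 0 ≤ f t := by
  intro t ht
  by_contra hneg
  obtain ⟨y, hy, hfy, hlt⟩ := exists_last_nonneg ht.1 (hc.mono (Icc_subset_Icc_right ht.2)) h0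
    (not_le.1 hneg)
  have hmono : MonotoneOn f (Icc y t) := by
    apply monotoneOn_of_deriv_nonneg (convex_Icc y t) (hc.mono (Icc_subset_Icc hy.1 ht.2))
    · intro u hu
      rw [interior_Icc] at hu
      exact (hd u ⟨hy.1.trans_lt hu.1, hu.2.trans_le ht.2⟩).differentiableAt.differentiableWithinAt
    · intro u hu
      rw [interior_Icc] at hu
      have hu' : u ∈ Ioo a b := ⟨hy.1.trans_lt hu.1, hu.2.trans_le ht.2⟩
      rw [(hd u hu').deriv]
      exact h u hu' (hlt u ⟨hu.1, hu.2.le⟩)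
  exact hneg (hfy.trans (hmono ⟨le_rfl, hy.2.le⟩ ⟨hy.2.le, le_rfl⟩ hy.2.le))

/-- Picard–Lindelöf for a bounded, globally Lipschitz vector field on a compact interval. -/
lemma exists_solution_of_lipschitz {f : ℝ → ℝ → ℝ} {a b x₀ L : ℝ} {K : NNReal} (hab : a ≤ b)
    (hf : ∀ x, ContinuousOn (fun t => f t x) (Icc a b))
    (hK : ∀ t ∈ Icc a b, LipschitzWith K (f t)) (hL : ∀ t ∈ Icc a b, ∀ x, |f t x| ≤ L) :
    ∃ u : ℝ → ℝ, u a = x₀ ∧ ∀ t ∈ Icc a b, HasDerivWithinAt u (f t (u t)) (Icc a b) t := by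
  have hL0 : 0 ≤ L := (abs_nonneg _).trans (hL a ⟨le_rfl, hab⟩ 0)
  have hba : 0 ≤ b - a := sub_nonneg.2 hab
  have hp : IsPicardLindelof f (⟨a, le_rfl, hab⟩ : Icc a b) x₀ (⟨L * (b - a), by positivity⟩)
      0 ⟨L, hL0⟩ K :=
    { lipschitzOnWith := fun t ht => (hK t ht).lipschitzOnWith
      continuousOn := fun x _ => hf x
      norm_le := fun t ht x _ => hL t ht x
      mul_max_le := by
        change L * max (b - a) (a - a) ≤ L * (b - a) - 0
        rw [sub_self, max_eq_left hba, sub_zero] }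
  exact hp.exists_eq_forall_mem_Icc_hasDerivWithinAt₀

lemma intervalIntegral_eq_sub_of_hasDerivWithinAt {u v : ℝ → ℝ} {a b t : ℝ}
    (hu : ∀ s ∈ Icc a b, HasDerivWithinAt u (v s) (Icc a b) s) (hv : ContinuousOn v (Icc a b))
    (ht : t ∈ Icc a b) : ∫ s in a..t, v s = u t - u a := by
  have hsub : Icc a t ⊆ Icc a b := Icc_subset_Icc_right ht.2
  apply intervalIntegral.integral_eq_sub_of_hasDerivAt_of_le ht.1
  · exact fun s hs => ((hu s (hsub hs)).continuousWithinAt).mono hsub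
  · intro s hs
    exact (hu s (hsub (Ioo_subset_Icc_self hs))).hasDerivAt
      (Icc_mem_nhds hs.1 (hs.2.trans_le ht.2))
  · exact (hv.mono (by rwa [uIcc_of_le ht.1])).intervalIntegrable

/-- Existence for a bounded continuous vector field that is nonincreasing in the state and is a
uniform limit of Lipschitz fields. -/
theorem exists_solution_of_antitone {f : ℝ → ℝ → ℝ} {F : ℕ → ℝ → ℝ → ℝ} {ε : ℕ → ℝ}
    {a b x₀ L : ℝ} (hab : a ≤ b)
    (hf : ContinuousOn (Function.uncurry f) (Icc a b ×ˢ univ))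
    (hanti : ∀ t ∈ Icc a b, Antitone (f t)) (hL : ∀ t ∈ Icc a b, ∀ x, |f t x| ≤ L)
    (hF : ∀ n, ContinuousOn (Function.uncurry (F n)) (Icc a b ×ˢ univ))
    (hlip : ∀ n, ∃ K : NNReal, ∀ t ∈ Icc a b, LipschitzWith K (F n t))
    (happ : ∀ n, ∀ t ∈ Icc a b, ∀ x, |F n t x - f t x| ≤ ε n) (hε : Tendsto ε atTop (𝓝 0)) :
    ∃ u : ℝ → ℝ, u a = x₀ ∧ ∀ t ∈ Icc a b, HasDerivWithinAt u (f t (u t)) (Icc a b) t := by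
  have haa : a ∈ Icc a b := ⟨le_rfl, hab⟩
  have hε0 : ∀ n, 0 ≤ ε n := fun n => (abs_nonneg _).trans (happ n a haa 0)
  have hcomp : ∀ G : ℝ → ℝ → ℝ, ContinuousOn (Function.uncurry G) (Icc a b ×ˢ univ) →
      ∀ u : ℝ → ℝ, ContinuousOn u (Icc a b) → ContinuousOn (fun t => G t (u t)) (Icc a b) := by
    intro G hG u hu
    exact hG.comp (f := fun t => (t, u t)) (continuousOn_id.prodMk hu) fun t ht => ⟨ht, mem_univ _⟩
  have hbound : ∀ n, ∀ t ∈ Icc a b, ∀ x, |F n t x| ≤ L + ε n := by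
    intro n t ht x
    have h1 := abs_le.1 (happ n t ht x)
    have h2 := abs_le.1 (hL t ht x)
    exact abs_le.2 ⟨by linarith, by linarith⟩
  have hex : ∀ n, ∃ u : ℝ → ℝ, u a = x₀ ∧
      ∀ t ∈ Icc a b, HasDerivWithinAt u (F n t (u t)) (Icc a b) t := by
    intro n
    obtain ⟨K, hK⟩ := hlip n
    exact exists_solution_of_lipschitz hab
      (fun x => hcomp _ (hF n) _ continuousOn_const) hK (hbound n)
  choose u hua hu using hex
  have huc : ∀ n, ContinuousOn (u n) (Icc a b) := fun n t ht => (hu n t ht).continuousWithinAt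
  have hud : ∀ n, ∀ t ∈ Ioo a b, HasDerivAt (u n) (F n t (u n t)) t := fun n t ht =>
    (hu n t (Ioo_subset_Icc_self ht)).hasDerivAt (Icc_mem_nhds ht.1 ht.2)
  -- Where `u n` exceeds `u m`, monotonicity of `f t` gives `f t (u n t) ≤ f t (u m t)`, so only the
  -- approximation errors can widen the gap.
  have hone : ∀ n m, ∀ t ∈ Icc a b, u n t - u m t ≤ (ε n + ε m) * (t - a) := by
    intro n m t ht
    have := nonneg_of_deriv_nonneg_of_neg
      (f := fun t => (ε n + ε m) * (t - a) - (u n t - u m t))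
      (f' := fun t => (ε n + ε m) * (1 - 0) - (F n t (u n t) - F m t (u m t)))
      (a := a) (b := b)
      ((continuousOn_const.mul (continuousOn_id.sub continuousOn_const)).sub ((huc n).sub (huc m)))
      (fun t ht => (((hasDerivAt_id t).sub (hasDerivAt_const t a)).const_mul _).sub
        ((hud n t ht).sub (hud m t ht)))
      (by simp [hua])
      (by
        intro t ht hneg
        have ht' := Ioo_subset_Icc_self ht
        have hpos : u m t ≤ u n t := by
          have : 0 ≤ (ε n + ε m) * (t - a) :=
            mul_nonneg (add_nonneg (hε0 n) (hε0 m)) (sub_nonneg.2 ht.1.le)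
          linarith
        have h1 := abs_le.1 (happ n t ht' (u n t))
        have h2 := abs_le.1 (happ m t ht' (u m t))
        have h3 := hanti t ht' hpos
        linarith)
      t ht
    linarith
  have habs : ∀ n m, ∀ t ∈ Icc a b, |u n t - u m t| ≤ (ε n + ε m) * (b - a) := by
    intro n m t ht
    have h1 := hone n m t ht
    have h2 := hone m n t ht
    have h3 : (ε n + ε m) * (t - a) ≤ (ε n + ε m) * (b - a) :=
      mul_le_mul_of_nonneg_left (by linarith [ht.2]) (add_nonneg (hε0 n) (hε0 m))
    exact abs_le.2 ⟨by linarith, by linarith⟩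
  have hcau : UniformCauchySeqOn u atTop (Icc a b) := by
    rw [Metric.uniformCauchySeqOn_iff]
    intro δ hδ
    have hlim : Tendsto (fun n => ε n * (b - a)) atTop (𝓝 0) := by
      simpa using hε.mul_const (b - a)
    obtain ⟨N, hN⟩ := (hlim.eventually (gt_mem_nhds (half_pos hδ))).exists_forall_of_atTop
    refine ⟨N, fun m hm n hn t ht => ?_⟩
    rw [Real.dist_eq]
    have := habs m n t ht
    have h1 := hN m hm
    have h2 := hN n hn
    nlinarith
  have hpt : ∀ t ∈ Icc a b, ∃ y, Tendsto (fun n => u n t) atTop (𝓝 y) := fun t ht =>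
    cauchySeq_tendsto_of_complete (hcau.cauchySeq ht)
  choose! w hw using hpt
  have hunif : TendstoUniformlyOn u w atTop (Icc a b) :=
    hcau.tendstoUniformlyOn_of_tendsto fun t ht => hw t ht
  have hwc : ContinuousOn w (Icc a b) :=
    hunif.continuousOn (Frequently.of_forall huc)
  have hfw := hcomp f hf w hwc
  have hwa : w a = x₀ := by
    refine tendsto_nhds_unique (hw a haa) ?_
    simp [hua]
  obtain ⟨E, hE⟩ : ∃ E, ∀ n, ε n ≤ E := by
    obtain ⟨E, hE⟩ := hε.bddAbove_range
    exact ⟨E, fun n => hE ⟨n, rfl⟩⟩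
  -- The limit is taken in the integral equation, because convergence of the derivatives is not
  -- known in advance.
  have hint : ∀ t ∈ Icc a b, w t = x₀ + ∫ s in a..t, f s (w s) := by
    intro t ht
    have hsub : ∀ s ∈ uIoc a t, s ∈ Icc a b := by
      intro s hs
      rw [uIoc_of_le ht.1] at hs
      exact ⟨hs.1.le, hs.2.trans ht.2⟩
    have hconv : Tendsto (fun n => ∫ s in a..t, F n s (u n s)) atTop
        (𝓝 (∫ s in a..t, f s (w s))) := by
      apply intervalIntegral.tendsto_integral_filter_of_dominated_convergence (fun _ => L + E)
      · refine Eventually.of_forall fun n => ?_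
        apply ((hcomp _ (hF n) _ (huc n)).mono _).aestronglyMeasurable measurableSet_uIoc
        exact hsub
      · refine Eventually.of_forall fun n => Eventually.of_forall fun s hs => ?_
        exact (hbound n s (hsub s hs) _).trans (by linarith [hE n])
      · simp
      · refine Eventually.of_forall fun s hs => ?_
        have hs' := hsub s hs
        have h1 : Tendsto (fun n => f s (u n s)) atTop (𝓝 (f s (w s))) := by
          have hcs : ContinuousOn (f s) univ :=
            hf.comp (f := fun x => (s, x)) (by fun_prop) fun x _ => ⟨hs', mem_univ _⟩
          exact ((continuousOn_univ.1 hcs).tendsto _).comp (hw s hs')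
        have h2 : Tendsto (fun n => F n s (u n s) - f s (u n s)) atTop (𝓝 0) :=
          squeeze_zero_norm (fun n => happ n s hs' _) hε
        simpa using h2.add h1
    have hlhs : ∀ n, ∫ s in a..t, F n s (u n s) = u n t - x₀ := by
      intro n
      rw [← hua n]
      exact intervalIntegral_eq_sub_of_hasDerivWithinAt (hu n) (hcomp _ (hF n) _ (huc n)) ht
    simp_rw [hlhs] at hconv
    have := tendsto_nhds_unique hconv ((hw t ht).sub_const x₀)
    linarith
  refine ⟨w, hwa, fun t ht => ?_⟩
  have hd : HasDerivWithinAt (fun t => x₀ + ∫ s in a..t, f s (w s)) (f t (w t)) (Icc a b) t := by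
    apply HasDerivWithinAt.const_add
    have : Fact (t ∈ Icc a b) := ⟨ht⟩
    refine intervalIntegral.integral_hasDerivWithinAt_right
      ((hfw.mono ?_).intervalIntegrable) ?_ (hfw t ht)
    · rw [uIcc_of_le ht.1]
      exact Icc_subset_Icc_right ht.2
    · exact ⟨Icc a b, self_mem_nhdsWithin, hfw.aestronglyMeasurable measurableSet_Icc⟩
  exact hd.congr hint (hint t ht)

/-- A scalar autonomous equation with positive, bounded, continuous speed has a global solution. -/
theorem exists_global_solution_of_pos {η : ℝ → ℝ} {K : ℝ} (hη : Continuous η)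
    (hpos : ∀ v, 0 < η v) (hK : ∀ v, η v ≤ K) :
    ∃ v : ℝ → ℝ, v 0 = 0 ∧ ∀ t, HasDerivAt v (η (v t)) t := by
  have hc : Continuous fun v => (η v)⁻¹ := hη.inv₀ fun v => (hpos v).ne'
  have hK0 : 0 < K := (hpos 0).trans_le (hK 0)
  -- Separation of variables: `T x` is the time at which the solution reaches `x`, and the solution
  -- is the inverse of `T`.
  let T : ℝ → ℝ := fun x => ∫ v in (0 : ℝ)..x, (η v)⁻¹
  have hT : ∀ x, HasDerivAt T (η x)⁻¹ x := fun x => hc.integral_hasStrictDerivAt 0 x |>.hasDerivAt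
  have hTc : Continuous T := continuous_iff_continuousAt.2 fun x => (hT x).continuousAt
  have hmono : StrictMono T := strictMono_of_deriv_pos fun x => by
    rw [(hT x).deriv]
    exact inv_pos.2 (hpos x)
  have hTK : ∀ x, HasDerivAt (fun x => T x - K⁻¹ * x) ((η x)⁻¹ - K⁻¹) x := fun x => by
    simpa using (hT x).fun_sub ((hasDerivAt_id x).const_mul K⁻¹)
  -- Bounded speed means that unbounded distances take unbounded time, so `T` is onto and the
  -- solution is global.
  have hgrow : Monotone fun x => T x - K⁻¹ * x := by
    refine monotone_of_deriv_nonneg (fun x => (hTK x).differentiableAt) fun x => ?_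
    rw [(hTK x).deriv, sub_nonneg]
    exact inv_anti₀ (hpos x) (hK x)
  have hT0 : T 0 = 0 := intervalIntegral.integral_same
  have hsurj : Function.Surjective T := by
    apply hTc.surjective
    · refine tendsto_atTop_mono' _ ?_ (tendsto_id.const_mul_atTop (inv_pos.2 hK0))
      filter_upwards [eventually_ge_atTop 0] with x hx
      have := hgrow hx
      simp only [hT0, id] at this ⊢
      linarith
    · refine tendsto_atBot_mono' _ ?_ (tendsto_id.const_mul_atBot (inv_pos.2 hK0))
      filter_upwards [eventually_le_atBot 0] with x hx
      have := hgrow hx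
      simp only [hT0, id] at this ⊢
      linarith
  let e := hmono.orderIsoOfSurjective T hsurj
  have heT : ∀ t, T (e.symm t) = t := fun t => e.apply_symm_apply t
  refine ⟨e.symm, ?_, fun t => ?_⟩
  · exact hmono.injective (by rw [heT, hT0])
  · have := (hT (e.symm t)).of_local_left_inverse e.symm.continuous.continuousAt
      (inv_ne_zero (hpos _).ne') (Eventually.of_forall heT)
    simpa using this

/-! ### A chain rule along Lipschitz paths -/

/-- Fundamental theorem of calculus for a discounted `C¹` function of an indefinite integral. -/
theorem integral_exp_mul_comp_integral {φ φ' x : ℝ → ℝ} {r T : ℝ} (hT : 0 ≤ T)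
    (hφ : ∀ y, HasDerivAt φ (φ' y) y) (hφ' : Continuous φ')
    (hx : IntervalIntegrable x volume 0 T) (hb : ∀ u ∈ Icc 0 T, |x u| ≤ 1) :
    ∫ τ in (0 : ℝ)..T, Real.exp (-(r * τ)) *
        (φ' (∫ u in (0 : ℝ)..τ, x u) * x τ - r * φ (∫ u in (0 : ℝ)..τ, x u)) =
      Real.exp (-(r * T)) * φ (∫ u in (0 : ℝ)..T, x u) - φ 0 := by
  set X : ℝ → ℝ := fun τ => ∫ u in (0 : ℝ)..τ, x u with hX
  have hsubint : ∀ u ∈ Icc 0 T, ∀ v ∈ Icc 0 T, IntervalIntegrable x volume u v := fun u hu v hv =>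
    hx.mono_set (by rw [uIcc_of_le hT]; exact uIcc_subset_Icc hu hv)
  have h0T : (0 : ℝ) ∈ Icc 0 T := ⟨le_rfl, hT⟩
  have hXlip : LipschitzOnWith 1 X (Icc 0 T) := by
    refine LipschitzOnWith.of_dist_le_mul fun u hu v hv => ?_
    rw [Real.dist_eq, Real.dist_eq, hX]
    simp only
    rw [intervalIntegral.integral_interval_sub_left (hsubint 0 h0T u hu) (hsubint 0 h0T v hv)]
    refine intervalIntegral.norm_integral_le_of_norm_le_const (f := x) (C := 1) fun w hw => ?_
    exact hb w (uIcc_subset_Icc hv hu (uIoc_subset_uIcc hw))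
  have hφ1 : ContDiff ℝ 1 φ := by
    rw [contDiff_one_iff_deriv]
    refine ⟨fun y => (hφ y).differentiableAt, ?_⟩
    convert hφ' using 1
    exact funext fun y => (hφ y).deriv
  obtain ⟨K, hK⟩ : ∃ K : NNReal, LipschitzOnWith K φ (X '' Icc 0 T) :=
    (LocallyLipschitz.locallyLipschitzOn (hφ1.locallyLipschitz (𝕂 := ℝ))).exists_lipschitzOnWith_of_compact
      (isCompact_Icc.image_of_continuousOn hXlip.continuousOn)
  -- The rate `x` is merely integrable and bounded, so `X` is differentiable only almost everywhere.
  -- Absolute continuity is what justifies the fundamental theorem here.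
  have hac1 : AbsolutelyContinuousOnInterval (fun τ => φ (X τ)) 0 T := by
    apply LipschitzOnWith.absolutelyContinuousOnInterval (K := K * 1)
    rw [uIcc_of_le hT]
    exact hK.comp hXlip (mapsTo_image X _)
  have hac2 : AbsolutelyContinuousOnInterval (fun τ => Real.exp (-(r * τ))) 0 T :=
    ContDiffOn.absolutelyContinuousOnInterval
      (ContDiff.contDiffOn (by fun_prop : ContDiff ℝ 1 fun τ : ℝ => Real.exp (-(r * τ))))
  have hftc := hac2.integral_deriv_mul_eq_sub hac1
  have hX0 : X 0 = 0 := intervalIntegral.integral_same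
  rw [hX0, mul_zero, neg_zero, Real.exp_zero, one_mul] at hftc
  rw [← hftc]
  apply intervalIntegral.integral_congr_ae
  filter_upwards [hx.ae_hasDerivAt_integral] with τ h1 h2
  have hd := (hφ (X τ)).comp τ (h1 (uIoc_subset_uIcc h2) 0 (by simp))
  have he : HasDerivAt (fun τ => Real.exp (-(r * τ))) (Real.exp (-(r * τ)) * (-(r * 1))) τ :=
    ((hasDerivAt_id τ).const_mul r).neg.exp
  rw [he.deriv, show deriv (fun τ => φ (X τ)) τ = φ' (X τ) * x τ from hd.deriv]
  ring

/-! ### The law of the reporting cost and the expected excess -/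

namespace Market

variable (M : Market)

lemma cbar_pos : 0 < M.cbar := by
  have h1 : 0 < M.lam / M.r := div_pos M.lam_pos M.r_pos
  have h2 : 0 < M.lam * M.z - M.s := sub_pos.2 M.s_lt
  exact (by positivity : (0 : ℝ) < (M.lam / M.r + 1) * (M.lam * M.z - M.s)).trans M.cbar_large

lemma h_aemeasurable : AEMeasurable M.h (volume.restrict (Ioo 0 M.cbar)) :=
  M.h_smooth.continuousOn.aemeasurable measurableSet_Ioo

/-- The finite one-sided limits extend `h` continuously to the compact interval `[0, cbar]`. -/
lemma exists_h_le : ∃ K, 0 < K ∧ ∀ c ∈ Ioo 0 M.cbar, M.h c ≤ K := by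
  obtain ⟨l₁, -, hl₁⟩ := M.h_left
  obtain ⟨l₂, -, hl₂⟩ := M.h_right
  have hc := continuousOn_Icc_extendFrom_Ioo M.h_smooth.continuousOn hl₁ hl₂
  obtain ⟨K, hK⟩ := isCompact_Icc.exists_bound_of_continuousOn hc
  have hle : ∀ c ∈ Ioo 0 M.cbar, M.h c ≤ K := by
    intro c hcm
    have := hK c (Ioo_subset_Icc_self hcm)
    have hext : extendFrom (Ioo 0 M.cbar) M.h c = M.h c :=
      extendFrom_eq (subset_closure hcm) (M.h_smooth.continuousOn c hcm)
    rw [hext] at this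
    exact (le_abs_self _).trans this
  refine ⟨K, ?_, hle⟩
  have hm : M.cbar / 2 ∈ Ioo 0 M.cbar := ⟨by linarith [M.cbar_pos], by linarith [M.cbar_pos]⟩
  exact (M.h_pos _ hm).trans_le (hle _ hm)

/-- The distribution of the reporting cost. -/
noncomputable def costLaw : Measure ℝ :=
  (volume.restrict (Ioo 0 M.cbar)).withDensity fun c => ENNReal.ofReal (M.h c)

lemma h_ae_nonneg : ∀ᵐ c ∂volume.restrict (Ioo 0 M.cbar), 0 ≤ M.h c :=
  (ae_restrict_mem measurableSet_Ioo).mono fun c hc => (M.h_pos c hc).le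

lemma expect_eq (f : ℝ → ℝ) : M.expect f = ∫ c, f c ∂M.costLaw := by
  rw [expect, costLaw, integral_withDensity_eq_integral_toReal_smul₀
    M.h_aemeasurable.ennreal_ofReal (ae_of_all _ fun _ => ENNReal.ofReal_lt_top),
    intervalIntegral.integral_of_le M.cbar_pos.le, integral_Ioc_eq_integral_Ioo]
  refine integral_congr_ae (M.h_ae_nonneg.mono fun c hc => ?_)
  simp only [smul_eq_mul]
  rw [ENNReal.toReal_ofReal hc, mul_comm]

instance : IsProbabilityMeasure M.costLaw := by
  constructor
  have h1 : ∫ c in Ioo 0 M.cbar, M.h c = 1 := by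
    rw [← integral_Ioc_eq_integral_Ioo, ← intervalIntegral.integral_of_le M.cbar_pos.le, M.h_total]
  have hint : Integrable M.h (volume.restrict (Ioo 0 M.cbar)) := by
    -- A non-integrable density would have integral `0` by convention, contradicting total mass `1`.
    by_contra hn
    rw [integral_undef hn] at h1
    exact zero_ne_one h1
  rw [costLaw, withDensity_apply _ MeasurableSet.univ, Measure.restrict_univ,
    ← ofReal_integral_eq_lintegral_ofReal hint M.h_ae_nonneg, h1, ENNReal.ofReal_one]

lemma ae_mem_Ioo : ∀ᵐ c ∂M.costLaw, c ∈ Ioo 0 M.cbar :=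
  (withDensity_absolutelyContinuous _ _).ae_le (ae_restrict_mem measurableSet_Ioo)

/-- Probability that the reporting cost is below `b`. -/
noncomputable def probBelow (b : ℝ) : ℝ := M.costLaw.real (Iio b)

/-- Expected excess of `b` over the reporting cost. -/
noncomputable def excess (b : ℝ) : ℝ := ∫ c, max (b - c) 0 ∂M.costLaw

lemma probBelow_nonneg (b : ℝ) : 0 ≤ M.probBelow b := measureReal_nonneg

lemma integrable_of_bound {f : ℝ → ℝ} (hf : Measurable f) {C : ℝ}
    (hC : ∀ c ∈ Ioo 0 M.cbar, |f c| ≤ C) : Integrable f M.costLaw :=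
  Integrable.of_bound hf.aestronglyMeasurable C (M.ae_mem_Ioo.mono hC)

lemma integrable_excess (b : ℝ) : Integrable (fun c => max (b - c) 0) M.costLaw := by
  refine M.integrable_of_bound (by fun_prop) (C := |b|) fun c hc => ?_
  rw [abs_of_nonneg (le_max_right _ _)]
  exact max_le (by linarith [le_abs_self b, hc.1]) (abs_nonneg b)

lemma integral_indicator_Iio (b k : ℝ) :
    ∫ c, (Iio b).indicator (fun _ => k) c ∂M.costLaw = M.probBelow b * k := by
  rw [integral_indicator measurableSet_Iio, setIntegral_const, smul_eq_mul, probBelow]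

/-- `excess` is convex and `probBelow b` is a subgradient at `b`: every cost below `b` gains the
whole increment. -/
lemma probBelow_mul_le_excess_sub {b b' : ℝ} (hb : b ≤ b') :
    M.probBelow b * (b' - b) ≤ M.excess b' - M.excess b := by
  rw [excess, excess, ← integral_sub (M.integrable_excess b') (M.integrable_excess b),
    ← integral_indicator_Iio]
  refine integral_mono ((integrable_const _).indicator measurableSet_Iio)
    ((M.integrable_excess b').sub (M.integrable_excess b)) fun c => ?_
  by_cases hc : c < b
  · simp only
    rw [indicator_of_mem (mem_Iio.2 hc), max_eq_left (by linarith), max_eq_left (by linarith)]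
    linarith
  · simp only
    rw [indicator_of_notMem (by simpa using hc), max_eq_right (by linarith : b - c ≤ 0), sub_zero]
    exact le_max_right _ _

lemma excess_mono : Monotone M.excess := fun b b' hb => by
  have := M.probBelow_mul_le_excess_sub hb
  nlinarith [M.probBelow_nonneg b]

lemma excess_sub_le {b b' : ℝ} (hb : b ≤ b') : M.excess b' - M.excess b ≤ b' - b := by
  have h1 : ∫ _c, (b' - b) ∂M.costLaw = b' - b := by simp
  rw [excess, excess, ← integral_sub (M.integrable_excess b') (M.integrable_excess b), ← h1]
  refine integral_mono ((M.integrable_excess b').sub (M.integrable_excess b))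
    (integrable_const _) fun c => ?_
  simp only
  rcases max_cases (b' - c) 0 with h | h <;> rcases max_cases (b - c) 0 with h' | h' <;> linarith

lemma continuous_excess : Continuous M.excess := by
  refine (LipschitzWith.of_le_add_mul 1 fun b b' => ?_).continuous
  rw [NNReal.coe_one, one_mul, Real.dist_eq]
  rcases le_total b b' with h | h
  · linarith [M.excess_mono h, abs_nonneg (b - b')]
  · linarith [M.excess_sub_le h, le_abs_self (b - b')]

lemma excess_nonneg (b : ℝ) : 0 ≤ M.excess b := integral_nonneg fun _ => le_max_right _ _

lemma excess_of_nonpos {b : ℝ} (hb : b ≤ 0) : M.excess b = 0 := by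
  refine integral_eq_zero_of_ae (M.ae_mem_Ioo.mono fun c hc => ?_)
  exact max_eq_right (by linarith [hc.1])

lemma sub_cbar_le_excess (b : ℝ) : b - M.cbar ≤ M.excess b := by
  have h1 : ∫ _c, (b - M.cbar) ∂M.costLaw = b - M.cbar := by simp
  rw [← h1, excess]
  refine integral_mono_ae (integrable_const _) (M.integrable_excess b)
    (M.ae_mem_Ioo.mono fun c hc => ?_)
  exact (by linarith [hc.2] : b - M.cbar ≤ b - c).trans (le_max_left _ _)

/-- Combined with `probBelow b ≤ K * b`, this gives the quadratic bound on `excess` behind the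
square-root growth of its inverse. -/
lemma excess_le_mul_probBelow {b : ℝ} (hb : 0 ≤ b) : M.excess b ≤ M.probBelow b * b := by
  rw [excess, ← integral_indicator_Iio]
  refine integral_mono_ae (M.integrable_excess b)
    ((integrable_const _).indicator measurableSet_Iio) (M.ae_mem_Ioo.mono fun c hc => ?_)
  by_cases hcb : c < b
  · simp only
    rw [indicator_of_mem (mem_Iio.2 hcb)]
    exact max_le (by linarith [hc.1]) hb
  · simp only
    rw [indicator_of_notMem (by simpa using hcb), max_eq_right (by linarith)]

lemma probBelow_pos {b : ℝ} (hb : 0 < b) : 0 < M.probBelow b := by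
  rw [probBelow, measureReal_def, ENNReal.toReal_pos_iff]
  refine ⟨pos_iff_ne_zero.2 fun h0 => ?_, measure_lt_top _ _⟩
  have h1 : ∀ᵐ c ∂M.costLaw, ¬ c < b := by
    simp only [ae_iff, not_not]
    exact h0
  rw [costLaw, ae_withDensity_iff' M.h_aemeasurable.ennreal_ofReal,
    ae_restrict_iff' measurableSet_Ioo] at h1
  have h2 : volume (Ioo 0 (min b M.cbar)) = 0 := by
    refine measure_mono_null (fun c hc => ?_) (ae_iff.1 h1)
    simp only [mem_ofPred_eq, not_forall, not_not]
    have hc' : c ∈ Ioo 0 M.cbar := ⟨hc.1, hc.2.trans_le (min_le_right _ _)⟩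
    exact ⟨hc', (ENNReal.ofReal_pos.2 (M.h_pos c hc')).ne', hc.2.trans_le (min_le_left _ _)⟩
  rw [Real.volume_Ioo, ENNReal.ofReal_eq_zero, sub_zero] at h2
  exact absurd (lt_min hb M.cbar_pos) (not_lt.2 h2)

lemma exists_probBelow_lipschitz :
    ∃ K, 0 < K ∧ ∀ b b', b ≤ b' →
      M.probBelow b ≤ M.probBelow b' ∧ M.probBelow b' - M.probBelow b ≤ K * (b' - b) := by
  obtain ⟨K, hK, hle⟩ := M.exists_h_le
  refine ⟨K, hK, fun b b' hb => ⟨measureReal_mono (Iio_subset_Iio hb), ?_⟩⟩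
  have h1 : M.probBelow b' - M.probBelow b = M.costLaw.real (Ico b b') := by
    have : Ico b b' = Iio b' \ Iio b := by
      ext c
      simp
    rw [this, measureReal_sdiff (Iio_subset_Iio hb) measurableSet_Iio]
    rfl
  have h2 : M.costLaw (Ico b b') ≤ ENNReal.ofReal (K * (b' - b)) := by
    rw [costLaw, withDensity_apply _ measurableSet_Ico, ENNReal.ofReal_mul hK.le,
      ← Real.volume_Ico, ← setLIntegral_const,
      Measure.restrict_restrict measurableSet_Ico]
    refine (setLIntegral_mono' (measurableSet_Ico.inter measurableSet_Ioo) fun c hc =>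
      ENNReal.ofReal_le_ofReal (hle c hc.2)).trans ?_
    exact lintegral_mono_set inter_subset_left
  rw [h1]
  exact ENNReal.toReal_le_of_le_ofReal (mul_nonneg hK.le (sub_nonneg.2 hb)) h2

lemma probBelow_zero : M.probBelow 0 = 0 := by
  rw [probBelow, measureReal_def]
  have : M.costLaw (Iio 0) = 0 := by
    refine measure_mono_null (fun c hc => ?_) (ae_iff.1 M.ae_mem_Ioo)
    exact fun h => absurd h.1 (not_lt.2 (le_of_lt hc))
  rw [this, ENNReal.toReal_zero]

lemma exists_probBelow_le : ∃ K, 0 < K ∧ ∀ b, 0 ≤ b → M.probBelow b ≤ K * b := by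
  obtain ⟨K, hK, h⟩ := M.exists_probBelow_lipschitz
  refine ⟨K, hK, fun b hb => ?_⟩
  have := (h 0 b hb).2
  rwa [M.probBelow_zero, sub_zero, sub_zero] at this

lemma continuous_probBelow : Continuous M.probBelow := by
  obtain ⟨K, hK, h⟩ := M.exists_probBelow_lipschitz
  refine (LipschitzWith.of_le_add_mul K.toNNReal fun b b' => ?_).continuous
  rw [Real.coe_toNNReal K hK.le, Real.dist_eq]
  rcases le_total b b' with hb | hb
  · linarith [(h _ _ hb).1, mul_nonneg hK.le (abs_nonneg (b - b'))]
  · linarith [(h _ _ hb).2, mul_le_mul_of_nonneg_left (le_abs_self (b - b')) hK.le]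

/-- Inverse of `excess` on the half-line of nonnegative numbers. -/
theorem exists_excess_inverse : ∃ Φ : ℝ → ℝ, Continuous Φ ∧ Monotone Φ ∧
    (∀ w ≤ 0, Φ w = 0) ∧ (∀ w, 0 < w → 0 < Φ w) ∧ ∀ w, 0 ≤ w → M.excess (Φ w) = w := by
  -- `excess` vanishes on the negative half-line. The term `min b 0` makes it a strictly increasing
  -- bijection of the line without changing it on `b ≥ 0`.
  let T : ℝ → ℝ := fun b => M.excess b + min b 0
  have hTc : Continuous T := M.continuous_excess.add (by fun_prop)
  have hT0 : T 0 = 0 := by simp [T, M.excess_of_nonpos le_rfl]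
  have hmono : StrictMono T := by
    intro b b' hb
    rcases le_or_gt b 0 with h0 | h0
    · rcases le_or_gt b' 0 with h1 | h1
      · simp only [T]
        rw [M.excess_of_nonpos h0, M.excess_of_nonpos h1, min_eq_left h0, min_eq_left h1]
        linarith
      · have h2 := M.probBelow_mul_le_excess_sub (show b' / 2 ≤ b' by linarith)
        have h3 := M.probBelow_pos (half_pos h1)
        have h4 := M.excess_nonneg (b' / 2)
        simp only [T]
        rw [M.excess_of_nonpos h0, min_eq_left h0, min_eq_right h1.le]
        nlinarith
    · have h2 := M.probBelow_mul_le_excess_sub hb.le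
      have h3 := M.probBelow_pos h0
      simp only [T]
      rw [min_eq_right h0.le, min_eq_right (h0.trans hb).le]
      nlinarith
  have hsurj : Function.Surjective T := by
    apply hTc.surjective
    · refine tendsto_atTop_mono' _ ?_ (tendsto_atTop_add_const_right _ (-M.cbar) tendsto_id)
      filter_upwards [eventually_ge_atTop 0] with b hb
      have := M.sub_cbar_le_excess b
      simp only [T, id, min_eq_right hb]
      linarith
    · refine tendsto_atBot_mono' _ ?_ tendsto_id
      filter_upwards [eventually_le_atBot 0] with b hb
      simp only [T, id, min_eq_left hb, M.excess_of_nonpos hb]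
      linarith
  let e := hmono.orderIsoOfSurjective T hsurj
  have heT : ∀ w, T (e.symm w) = w := fun w => e.apply_symm_apply w
  have he0 : e.symm 0 = 0 := hmono.injective (by rw [heT, hT0])
  refine ⟨fun w => e.symm (max w 0), ?_, ?_, ?_, ?_, ?_⟩
  · exact e.symm.continuous.comp (by fun_prop)
  · exact e.symm.monotone.comp fun _ _ h => max_le_max_right 0 h
  · intro w hw
    simp only [max_eq_right hw, he0]
  · intro w hw
    simp only [max_eq_left hw.le]
    rw [← he0]
    exact e.symm.strictMono hw
  · intro w hw
    simp only [max_eq_left hw]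
    have h1 : 0 ≤ e.symm w := by
      rw [← he0]
      exact e.symm.monotone hw
    have h2 := heT w
    simp only [T, min_eq_right h1, add_zero] at h2
    exact h2

end Market

/-- Properties of the inverse of the expected excess of a cutoff over the reporting cost. -/
structure IsExcessInverse (Φ : ℝ → ℝ) : Prop where
  continuous : Continuous Φ
  monotone : Monotone Φ
  eq_zero : ∀ w ≤ 0, Φ w = 0
  pos : ∀ w, 0 < w → 0 < Φ w
  lipschitz : ∀ ε, 0 < ε → ∃ K, 0 ≤ K ∧ ∀ w w', |Φ (max w ε) - Φ (max w' ε)| ≤ K * |w - w'|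
  sqrt_le : ∃ κ, 0 < κ ∧ ∀ w, 0 ≤ w → κ * √w ≤ Φ w

lemma IsExcessInverse.nonneg {Φ : ℝ → ℝ} (hΦ : IsExcessInverse Φ) (w : ℝ) : 0 ≤ Φ w := by
  rcases le_or_gt w 0 with h | h
  · exact (hΦ.eq_zero w h).ge
  · exact (hΦ.pos w h).le

/-- Above level `ε` the slope of `excess` is at least `probBelow (Φ ε) > 0`, so the inverse is
Lipschitz there. Near `0` the bound `excess b ≤ K * b ^ 2` makes the inverse at least a multiple of
the square root. -/
theorem Market.exists_isExcessInverse (M : Market) :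
    ∃ Φ, IsExcessInverse Φ ∧ ∀ w, 0 ≤ w → M.excess (Φ w) = w := by
  obtain ⟨Φ, hc, hm, h0, hpos, hinv⟩ := M.exists_excess_inverse
  obtain ⟨K, hK, hKle⟩ := M.exists_probBelow_le
  refine ⟨Φ, ⟨hc, hm, h0, hpos, fun ε hε => ?_, ?_⟩, hinv⟩
  · have hH := M.probBelow_pos (hpos ε hε)
    refine ⟨(M.probBelow (Φ ε))⁻¹, (inv_pos.2 hH).le, ?_⟩
    have key : ∀ w w', w ≤ w' →
        |Φ (max w ε) - Φ (max w' ε)| ≤ (M.probBelow (Φ ε))⁻¹ * |w - w'| := by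
      intro w w' hw
      have h1 : Φ (max w ε) ≤ Φ (max w' ε) := hm (max_le_max_right ε hw)
      have h2 := M.probBelow_mul_le_excess_sub h1
      rw [hinv _ (hε.le.trans (le_max_right _ _)), hinv _ (hε.le.trans (le_max_right _ _))] at h2
      have h3 : M.probBelow (Φ ε) ≤ M.probBelow (Φ (max w ε)) :=
        measureReal_mono (Iio_subset_Iio (hm (le_max_right _ _)))
      have h4 : max w' ε - max w ε ≤ w' - w := by
        rcases max_cases w' ε with h | h <;> rcases max_cases w ε with h' | h' <;> linarith
      rw [abs_of_nonpos (sub_nonpos.2 h1), abs_of_nonpos (sub_nonpos.2 hw), inv_mul_eq_div,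
        le_div_iff₀ hH]
      nlinarith [mul_le_mul_of_nonneg_right h3 (sub_nonneg.2 h1)]
    intro w w'
    rcases le_total w w' with h | h
    · exact key w w' h
    · rw [abs_sub_comm, abs_sub_comm w]
      exact key w' w h
  · refine ⟨(√K)⁻¹, inv_pos.2 (Real.sqrt_pos.2 hK), fun w hw => ?_⟩
    have h1 : 0 ≤ Φ w := by
      rcases hw.eq_or_lt with h | h
      · exact (h0 w h.symm.le).ge
      · exact (hpos w h).le
    have h2 : w ≤ K * (Φ w) ^ 2 := by
      have := M.excess_le_mul_probBelow h1
      rw [hinv w hw] at this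
      nlinarith [mul_le_mul_of_nonneg_right (hKle _ h1) h1]
    rw [inv_mul_eq_div, div_le_iff₀ (Real.sqrt_pos.2 hK)]
    calc √w ≤ √(K * (Φ w) ^ 2) := Real.sqrt_le_sqrt h2
      _ = Φ w * √K := by rw [Real.sqrt_mul hK.le, Real.sqrt_sq h1, mul_comm]

/-! ### The value equation: existence and bounds -/

/-- `lam * t * (1 - t)` times the slope of the value function at belief `t` and value `x`. -/
noncomputable def valueDrift (Φ : ℝ → ℝ) (r lam g s t x : ℝ) : ℝ :=
  t * lam * (g / r - x) - max (s - g * t) 0 - Φ (r * x - max s (g * t))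

section

variable {Φ : ℝ → ℝ} {r lam g s : ℝ}

lemma valueDrift_antitone (hΦ : IsExcessInverse Φ) (hr : 0 < r) (hlam : 0 < lam) {t : ℝ}
    (ht : 0 ≤ t) : Antitone (valueDrift Φ r lam g s t) := by
  intro x y hxy
  have h1 : Φ (r * x - max s (g * t)) ≤ Φ (r * y - max s (g * t)) :=
    hΦ.monotone (by nlinarith)
  have h2 : t * lam * (g / r - y) ≤ t * lam * (g / r - x) :=
    mul_le_mul_of_nonneg_left (by linarith) (mul_nonneg ht hlam.le)
  simp only [valueDrift]
  linarith

/-- A higher belief raises the gain from good news, lowers the myopic loss and lowers the argument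
of `Φ`. The bound `x ≤ g / r` is what makes the first of these a gain. -/
lemma valueDrift_mono_left (hΦ : IsExcessInverse Φ) (hlam : 0 < lam) (hg : 0 < g) {t t' x : ℝ}
    (ht : t ≤ t') (hx : x ≤ g / r) :
    valueDrift Φ r lam g s t x ≤ valueDrift Φ r lam g s t' x := by
  have hgt : g * t ≤ g * t' := mul_le_mul_of_nonneg_left ht hg.le
  have h1 : Φ (r * x - max s (g * t')) ≤ Φ (r * x - max s (g * t)) :=
    hΦ.monotone (sub_le_sub_left (max_le_max_left s hgt) _)
  have h2 : t * lam * (g / r - x) ≤ t' * lam * (g / r - x) :=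
    mul_le_mul_of_nonneg_right (mul_le_mul_of_nonneg_right ht hlam.le) (by linarith)
  have h3 : max (s - g * t') 0 ≤ max (s - g * t) 0 := max_le_max_right 0 (by linarith)
  simp only [valueDrift]
  linarith

lemma continuous_valueDrift (hΦ : IsExcessInverse Φ) {t x : ℝ → ℝ} {S : Set ℝ}
    (ht : ContinuousOn t S) (hx : ContinuousOn x S) :
    ContinuousOn (fun y => valueDrift Φ r lam g s (t y) (x y)) S := by
  have := hΦ.continuous
  unfold valueDrift
  fun_prop

/-- Truncated value equation: existence on a compact interval of beliefs. -/
theorem exists_truncated_solution (hΦ : IsExcessInverse Φ) (hr : 0 < r) (hlam : 0 < lam)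
    (hs : 0 < s) (hsg : s < g) {a b x₀ : ℝ} (ha : 0 < a) (hab : a ≤ b) (hb : b < 1) :
    ∃ u : ℝ → ℝ, u a = x₀ ∧ ∀ t ∈ Icc a b,
      HasDerivWithinAt u (valueDrift Φ r lam g s t (max 0 (min (u t) (g / r))) /
        (lam * (t * (1 - t)))) (Icc a b) t := by
  have hg : 0 < g := hs.trans hsg
  have hc := hΦ.continuous
  have hb0 : 0 < 1 - b := sub_pos.2 hb
  set m := lam * (a * (1 - b)) with hm
  have hm0 : 0 < m := by positivity
  have hden : ∀ t ∈ Icc a b, m ≤ lam * (t * (1 - t)) := by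
    intro t ht
    apply mul_le_mul_of_nonneg_left _ hlam.le
    exact mul_le_mul ht.1 (by linarith [ht.2]) hb0.le (ha.le.trans ht.1)
  have hden0 : ∀ t ∈ Icc a b, 0 < lam * (t * (1 - t)) := fun t ht => hm0.trans_le (hden t ht)
  have hdiv : ∀ t ∈ Icc a b, ∀ y E, |y| ≤ E → |y / (lam * (t * (1 - t)))| ≤ E / m := by
    intro t ht y E hy
    rw [abs_div, abs_of_pos (hden0 t ht)]
    exact div_le_div₀ ((abs_nonneg _).trans hy) hy hm0 (hden t ht)
  have hclip0 : ∀ x : ℝ, 0 ≤ max 0 (min x (g / r)) := fun x => le_max_left _ _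
  have hclip1 : ∀ x : ℝ, max 0 (min x (g / r)) ≤ g / r := fun x =>
    max_le (by positivity) (min_le_right _ _)
  have hcliplip : ∀ x y : ℝ, |max 0 (min x (g / r)) - max 0 (min y (g / r))| ≤ |x - y| := by
    intro x y
    refine (abs_max_sub_max_le_max 0 _ 0 _).trans ?_
    rw [sub_zero, abs_zero, max_eq_right (abs_nonneg _)]
    refine (abs_min_sub_min_le_max x _ y _).trans ?_
    rw [sub_self, abs_zero, max_eq_left (abs_nonneg _)]
  let δ : ℕ → ℝ := fun n => 1 / ((n : ℝ) + 1)
  have hδ : ∀ n, 0 < δ n := fun n => Nat.one_div_pos_of_nat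
  refine exists_solution_of_antitone
    -- Clipping the state to `[0, g / r]` bounds the field. Replacing `Φ x` by `Φ (max x (δ n))`
    -- makes it Lipschitz in the state, at the cost of an error of at most `Φ (δ n)` before
    -- division.
    (f := fun t x => valueDrift Φ r lam g s t (max 0 (min x (g / r))) / (lam * (t * (1 - t))))
    (F := fun n t x => (t * lam * (g / r - max 0 (min x (g / r))) - max (s - g * t) 0 -
      Φ (max (r * max 0 (min x (g / r)) - max s (g * t)) (δ n))) / (lam * (t * (1 - t))))
    (ε := fun n => Φ (δ n) / m) (L := (lam * (g / r) + s + Φ g) / m)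
    hab ?_ ?_ ?_ ?_ ?_ ?_ ?_
  · unfold valueDrift Function.uncurry
    refine ContinuousOn.div (Continuous.continuousOn (by fun_prop))
      (Continuous.continuousOn (by fun_prop)) fun z hz => (hden0 z.1 hz.1).ne'
  · intro t ht x y hxy
    refine div_le_div_of_nonneg_right ?_ (hden0 t ht).le
    exact valueDrift_antitone hΦ hr hlam (ha.le.trans ht.1)
      (max_le_max_left 0 (min_le_min_right _ hxy))
  · intro t ht x
    refine hdiv t ht _ _ ?_
    have ht0 : 0 ≤ t := ha.le.trans ht.1
    have ht1 : t ≤ 1 := ht.2.trans hb.le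
    have h0 := hclip0 x
    have h1 := hclip1 x
    set y := max 0 (min x (g / r))
    have h2 : 0 ≤ t * lam * (g / r - y) := mul_nonneg (by positivity) (by linarith)
    have h3 : t * lam * (g / r - y) ≤ lam * (g / r) :=
      mul_le_mul (by nlinarith) (by linarith) (by linarith) hlam.le
    have h4 : max (s - g * t) 0 ≤ s := max_le (by nlinarith) hs.le
    have h5 : 0 ≤ max (s - g * t) 0 := le_max_right _ _
    have h6 : Φ (r * y - max s (g * t)) ≤ Φ g := by
      apply hΦ.monotone
      have : r * y ≤ g := by
        rw [le_div_iff₀ hr] at h1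
        linarith
      linarith [le_max_left s (g * t)]
    have h7 := hΦ.nonneg (r * y - max s (g * t))
    rw [valueDrift, abs_le]
    constructor <;> linarith
  · intro n
    unfold Function.uncurry
    refine ContinuousOn.div (Continuous.continuousOn (by fun_prop))
      (Continuous.continuousOn (by fun_prop)) fun z hz => (hden0 z.1 hz.1).ne'
  · intro n
    obtain ⟨K, hK0, hK⟩ := hΦ.lipschitz (δ n) (hδ n)
    refine ⟨((lam + K * r) / m).toNNReal, fun t ht => LipschitzWith.of_dist_le_mul fun x y => ?_⟩
    have ht0 : 0 ≤ t := ha.le.trans ht.1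
    have ht1 : t ≤ 1 := ht.2.trans hb.le
    rw [Real.coe_toNNReal _ (by positivity), Real.dist_eq, Real.dist_eq, ← sub_div,
      div_mul_eq_mul_div]
    refine hdiv t ht _ _ ?_
    have h1 := hcliplip x y
    set x' := max 0 (min x (g / r))
    set y' := max 0 (min y (g / r))
    have h2 := hK (r * x' - max s (g * t)) (r * y' - max s (g * t))
    have h3 : |r * x' - max s (g * t) - (r * y' - max s (g * t))| = r * |x' - y'| := by
      rw [← abs_of_pos hr, ← abs_mul, abs_of_pos hr]
      ring_nf
    have h4 : |t * lam * (y' - x')| ≤ lam * |x' - y'| := by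
      rw [abs_mul, abs_of_nonneg (mul_nonneg ht0 hlam.le), abs_sub_comm]
      exact mul_le_mul_of_nonneg_right (by nlinarith) (abs_nonneg _)
    rw [h3] at h2
    calc _ = |t * lam * (y' - x') + (Φ (max (r * y' - max s (g * t)) (δ n)) -
          Φ (max (r * x' - max s (g * t)) (δ n)))| := by ring_nf
      _ ≤ lam * |x' - y'| + K * (r * |x' - y'|) := by
        refine (abs_add_le _ _).trans (add_le_add h4 ?_)
        rwa [abs_sub_comm]
      _ = (lam + K * r) * |x' - y'| := by ring
      _ ≤ _ := mul_le_mul_of_nonneg_left h1 (by positivity)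
  · intro n t ht x
    rw [← sub_div]
    refine hdiv t ht _ _ ?_
    rw [valueDrift]
    set w := r * max 0 (min x (g / r)) - max s (g * t)
    have h1 : Φ (max w (δ n)) = max (Φ w) (Φ (δ n)) := hΦ.monotone.map_max
    have h2 := hΦ.nonneg w
    have h3 := hΦ.nonneg (δ n)
    rw [h1]
    rcases max_cases (Φ w) (Φ (δ n)) with h | h <;> rw [h.1, abs_le] <;>
      constructor <;> linarith
  · have h1 : Tendsto δ atTop (𝓝 0) := tendsto_one_div_add_atTop_nhds_zero_nat
    have h2 := ((hc.tendsto 0).comp h1).div_const m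
    rw [hΦ.eq_zero 0 le_rfl, zero_div] at h2
    exact h2

end

section

variable {Φ : ℝ → ℝ} {r lam g s : ℝ}

/-- A solution of the value equation on `[a, b]` that starts from the safe value. -/
structure IsValueSolution (Φ : ℝ → ℝ) (r lam g s a b : ℝ) (u : ℝ → ℝ) : Prop where
  start : u a = s / r
  deriv : ∀ t ∈ Icc a b, HasDerivWithinAt u (valueDrift Φ r lam g s t (u t) /
    (lam * (t * (1 - t)))) (Icc a b) t
  safe_le : ∀ t ∈ Icc a b, s / r ≤ u t
  risky_le : ∀ t ∈ Icc a b, g * t / r ≤ u t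
  le_full : ∀ t ∈ Icc a b, u t ≤ g / r

lemma IsValueSolution.continuousOn {a b : ℝ} {u : ℝ → ℝ}
    (h : IsValueSolution Φ r lam g s a b u) : ContinuousOn u (Icc a b) :=
  fun t ht => (h.deriv t ht).continuousWithinAt

lemma IsValueSolution.hasDerivAt {a b : ℝ} {u : ℝ → ℝ}
    (h : IsValueSolution Φ r lam g s a b u) {t : ℝ} (ht : t ∈ Ioo a b) :
    HasDerivAt u (valueDrift Φ r lam g s t (u t) / (lam * (t * (1 - t)))) t :=
  (h.deriv t (Ioo_subset_Icc_self ht)).hasDerivAt (Icc_mem_nhds ht.1 ht.2)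

lemma IsValueSolution.mono {a b c : ℝ} {u : ℝ → ℝ}
    (h : IsValueSolution Φ r lam g s a b u) (hc : c ≤ b) : IsValueSolution Φ r lam g s a c u where
  start := h.start
  deriv t ht := (h.deriv t ⟨ht.1, ht.2.trans hc⟩).mono (Icc_subset_Icc_right hc)
  safe_le t ht := h.safe_le t ⟨ht.1, ht.2.trans hc⟩
  risky_le t ht := h.risky_le t ⟨ht.1, ht.2.trans hc⟩
  le_full t ht := h.le_full t ⟨ht.1, ht.2.trans hc⟩

/-- At `a` the informational gain `a * lam * (g - s) / r` equals the myopic loss `s - g * a`. Beyond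
it the gain grows and the loss shrinks. -/
lemma safe_start_ineq {a t : ℝ} (hr : 0 < r) (hlam : 0 < lam) (hs : 0 < s) (hsg : s < g)
    (ha : a * (lam * (g - s) / r + g) = s) (ht : a ≤ t) (ht0 : 0 ≤ t) :
    max (s - g * t) 0 ≤ t * lam * (g / r - s / r) := by
  have h0 : 0 < lam * (g - s) / r := div_pos (mul_pos hlam (sub_pos.2 hsg)) hr
  have h1 : t * lam * (g / r - s / r) = t * (lam * (g - s) / r) := by ring
  rw [h1]
  have hg : 0 < g := hs.trans hsg
  refine max_le ?_ (by positivity)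
  have : a * (lam * (g - s) / r + g) ≤ t * (lam * (g - s) / r + g) :=
    mul_le_mul_of_nonneg_right ht (by positivity)
  linarith

/-- The truncated solution never meets its truncation, by three barriers. Below `s / r` the term `Φ`
vanishes and the drift is nonnegative; above `g / r` the drift is nonpositive; below the line `g * t
/ r` the term `Φ` vanishes again and the solution is at least as steep as the line. -/
theorem exists_isValueSolution (hΦ : IsExcessInverse Φ) (hr : 0 < r) (hlam : 0 < lam)
    (hs : 0 < s) (hsg : s < g) {a b : ℝ} (ha0 : 0 < a)
    (ha : a * (lam * (g - s) / r + g) = s) (hab : a ≤ b) (hb : b < 1) :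
    ∃ u, IsValueSolution Φ r lam g s a b u := by
  have hg : 0 < g := hs.trans hsg
  have hsgr : s / r ≤ g / r := div_le_div_of_nonneg_right hsg.le hr.le
  have hsr : 0 ≤ s / r := by positivity
  obtain ⟨u, hua, hu⟩ := exists_truncated_solution (x₀ := s / r) hΦ hr hlam hs hsg ha0 hab hb
  have hden : ∀ t ∈ Icc a b, 0 < lam * (t * (1 - t)) := fun t ht =>
    mul_pos hlam (mul_pos (ha0.trans_le ht.1) (by linarith [ht.2]))
  have huc : ContinuousOn u (Icc a b) := fun t ht => (hu t ht).continuousWithinAt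
  have hud : ∀ t ∈ Ioo a b, HasDerivAt u (valueDrift Φ r lam g s t (max 0 (min (u t) (g / r))) /
      (lam * (t * (1 - t)))) t := fun t ht =>
    (hu t (Ioo_subset_Icc_self ht)).hasDerivAt (Icc_mem_nhds ht.1 ht.2)
  have hsafe : ∀ t ∈ Icc a b, 0 ≤ u t - s / r := by
    refine nonneg_of_deriv_nonneg_of_neg (huc.sub continuousOn_const)
      (fun t ht => (hud t ht).sub_const _) (by rw [hua, sub_self]) fun t ht hneg => ?_
    refine div_nonneg ?_ (hden t (Ioo_subset_Icc_self ht)).le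
    have hx : max 0 (min (u t) (g / r)) ≤ s / r :=
      max_le hsr ((min_le_left _ _).trans (by linarith))
    refine le_trans ?_ (valueDrift_antitone hΦ hr hlam (ha0.trans ht.1).le hx)
    have h1 := safe_start_ineq hr hlam hs hsg ha ht.1.le (ha0.trans ht.1).le
    rw [valueDrift, hΦ.eq_zero, sub_zero]
    · linarith
    · rw [mul_div_cancel₀ s hr.ne']
      linarith [le_max_left s (g * t)]
  have hfull : ∀ t ∈ Icc a b, 0 ≤ g / r - u t := by
    refine nonneg_of_deriv_nonneg_of_neg (continuousOn_const.sub huc)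
      (fun t ht => (hud t ht).const_sub _) (by rw [hua]; linarith) fun t ht hneg => ?_
    rw [neg_nonneg]
    refine div_nonpos_of_nonpos_of_nonneg ?_ (hden t (Ioo_subset_Icc_self ht)).le
    have hx : max 0 (min (u t) (g / r)) = g / r := by
      rw [min_eq_right (by linarith), max_eq_right (by positivity)]
    rw [hx, valueDrift, sub_self, mul_zero]
    have := hΦ.nonneg (r * (g / r) - max s (g * t))
    linarith [le_max_right (s - g * t) 0]
  have hclip : ∀ t ∈ Icc a b, max 0 (min (u t) (g / r)) = u t := by
    intro t ht
    rw [min_eq_left (by linarith [hfull t ht]), max_eq_right (by linarith [hsafe t ht])]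
  have hrisky : ∀ t ∈ Icc a b, 0 ≤ u t - g / r * t := by
    have hlin : ∀ t, HasDerivAt (fun t => g / r * t) (g / r) t := fun t => by
      simpa using (hasDerivAt_id t).const_mul (g / r)
    refine nonneg_of_deriv_nonneg_of_neg (huc.sub (by fun_prop))
      (fun t ht => (hud t ht).sub (hlin t)) ?_ fun t ht hneg => ?_
    · have h0 : 0 < lam * (g - s) / r := div_pos (mul_pos hlam (sub_pos.2 hsg)) hr
      have h1 : g * a ≤ s := by nlinarith
      rw [hua, div_mul_eq_mul_div, ← sub_div]
      exact div_nonneg (by linarith) hr.le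
    · have ht' := Ioo_subset_Icc_self ht
      have hx : r * u t < g * t := by
        have : u t < g * t / r := by
          rw [← div_mul_eq_mul_div]
          linarith
        rw [lt_div_iff₀ hr] at this
        linarith
      have hsx : s ≤ r * u t := by
        have := hsafe t ht'
        have : s / r ≤ u t := by linarith
        rw [div_le_iff₀ hr] at this
        linarith
      rw [hclip t ht', valueDrift, hΦ.eq_zero _ (by linarith [le_max_right s (g * t)]),
        max_eq_right (by linarith), sub_zero, sub_zero, sub_nonneg, le_div_iff₀ (hden t ht')]
      have h2 : u t ≤ g / r * t := by linarith
      have h3 : t * lam * (g / r - g / r * t) ≤ t * lam * (g / r - u t) :=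
        mul_le_mul_of_nonneg_left (by linarith) (mul_nonneg (ha0.trans ht.1).le hlam.le)
      linarith
  refine ⟨u, hua, fun t ht => ?_, fun t ht => ?_, fun t ht => ?_, fun t ht => ?_⟩
  · have := hu t ht
    rwa [hclip t ht] at this
  · linarith [hsafe t ht]
  · have := hrisky t ht
    rw [← div_mul_eq_mul_div]
    linarith
  · linarith [hfull t ht]

/-- The value is nondecreasing in the belief. -/
theorem IsValueSolution.valueDrift_nonneg {a b : ℝ} {u : ℝ → ℝ}
    (h : IsValueSolution Φ r lam g s a b u) (hΦ : IsExcessInverse Φ) (hr : 0 < r) (hlam : 0 < lam)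
    (hs : 0 < s) (hsg : s < g) (ha0 : 0 < a) (ha : a * (lam * (g - s) / r + g) = s)
    (hb : b < 1) : ∀ t ∈ Icc a b, 0 ≤ valueDrift Φ r lam g s t (u t) := by
  intro t ht
  by_contra hneg
  have hcont : ContinuousOn (fun y => valueDrift Φ r lam g s y (u y)) (Icc a t) :=
    continuous_valueDrift hΦ continuousOn_id (h.continuousOn.mono (Icc_subset_Icc_right ht.2))
  have hstart : 0 ≤ valueDrift Φ r lam g s a (u a) := by
    have h1 := safe_start_ineq hr hlam hs hsg ha le_rfl ha0.le
    rw [h.start, valueDrift, hΦ.eq_zero, sub_zero]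
    · linarith
    · rw [mul_div_cancel₀ s hr.ne']
      linarith [le_max_left s (g * a)]
  obtain ⟨y, hy, hfy, hlt⟩ := exists_last_nonneg ht.1 hcont hstart (not_le.1 hneg)
  -- A negative drift makes `u` fall from `y` to `t`. A lower value and a higher belief both raise
  -- the drift, so it cannot have become negative.
  have hanti : AntitoneOn u (Icc y t) := by
    apply antitoneOn_of_deriv_nonpos (convex_Icc y t)
      (h.continuousOn.mono (Icc_subset_Icc hy.1 ht.2))
    · intro v hv
      rw [interior_Icc] at hv
      exact (h.hasDerivAt ⟨hy.1.trans_lt hv.1, hv.2.trans_le ht.2⟩).differentiableAt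
        |>.differentiableWithinAt
    · intro v hv
      rw [interior_Icc] at hv
      rw [(h.hasDerivAt ⟨hy.1.trans_lt hv.1, hv.2.trans_le ht.2⟩).deriv]
      refine div_nonpos_of_nonpos_of_nonneg (hlt v ⟨hv.1, hv.2.le⟩).le ?_
      have hv0 : 0 < v := ha0.trans_le (hy.1.trans hv.1.le)
      have hv1 : 0 < 1 - v := by linarith [hv.2, ht.2]
      positivity
  have h1 : u t ≤ u y := hanti ⟨le_rfl, hy.2.le⟩ ⟨hy.2.le, le_rfl⟩ hy.2.le
  have h2 := valueDrift_antitone (g := g) (s := s) hΦ hr hlam (ha0.le.trans ht.1) h1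
  have h3 := valueDrift_mono_left (s := s) hΦ hlam (hs.trans hsg) hy.2.le
    (h.le_full y ⟨hy.1, hy.2.le.trans ht.2⟩)
  exact hneg (hfy.trans (h3.trans h2))

/-- Contact with `s / r` in the interior would be a local minimum, where the derivative vanishes,
whereas the drift at the safe value is strictly positive beyond `a`. -/
theorem IsValueSolution.safe_lt {a b : ℝ} {u : ℝ → ℝ}
    (h : IsValueSolution Φ r lam g s a b u) (hΦ : IsExcessInverse Φ) (hr : 0 < r) (hlam : 0 < lam)
    (hs : 0 < s) (hsg : s < g) (ha0 : 0 < a) (ha : a * (lam * (g - s) / r + g) = s)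
    (hb : b < 1) : ∀ t ∈ Ioo a b, s / r < u t := by
  intro t ht
  have ht' := Ioo_subset_Icc_self ht
  refine lt_of_le_of_ne (h.safe_le t ht') fun heq => ?_
  have hmin : IsLocalMin u t := by
    filter_upwards [Icc_mem_nhds ht.1 ht.2] with y hy
    rw [← heq]
    exact h.safe_le y hy
  have hz := hmin.hasDerivAt_eq_zero (h.hasDerivAt ht)
  have hden : 0 < lam * (t * (1 - t)) :=
    mul_pos hlam (mul_pos (ha0.trans ht.1) (by linarith [ht.2]))
  refine absurd hz (div_pos ?_ hden).ne'
  rw [← heq, valueDrift, hΦ.eq_zero, sub_zero, sub_pos]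
  · have h0 : 0 < lam * (g - s) / r := div_pos (mul_pos hlam (sub_pos.2 hsg)) hr
    have h1 : t * lam * (g / r - s / r) = t * (lam * (g - s) / r) := by ring
    have hg : 0 < g := hs.trans hsg
    rw [h1]
    refine max_lt ?_ (mul_pos (ha0.trans ht.1) h0)
    have : a * (lam * (g - s) / r + g) < t * (lam * (g - s) / r + g) :=
      mul_lt_mul_of_pos_right ht.1 (by positivity)
    linarith
  · rw [mul_div_cancel₀ s hr.ne']
    linarith [le_max_left s (g * t)]

/-- If beliefs close enough to one are allowed, then the value reaches the myopic risky value. -/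
theorem IsValueSolution.exists_le_risky {a b κ : ℝ} {u : ℝ → ℝ}
    (h : IsValueSolution Φ r lam g s a b u) (hr : 0 < r) (hlam : 0 < lam)
    (hs : 0 < s) (hsg : s < g) (hκ : 0 < κ) (hΦκ : ∀ w, 0 ≤ w → κ * √w ≤ Φ w)
    (ha : a ≤ s / g) (hb : b < 1) (hsb : s / g ≤ b)
    (hlog : √(g / r) < κ * √r / (2 * lam) * (Real.log (1 - s / g) - Real.log (1 - b))) :
    ∃ t ∈ Icc (s / g) b, r * u t ≤ g * t := by
  by_contra! hcon
  have hg : 0 < g := hs.trans hsg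
  have hsg0 : 0 < s / g := div_pos hs hg
  set k := κ * √r / (2 * lam) with hk
  have hk0 : 0 < k := div_pos (mul_pos hκ (Real.sqrt_pos.2 hr)) (by positivity)
  have hsub : Icc (s / g) b ⊆ Icc a b := Icc_subset_Icc_left ha
  have hV0 : ∀ t ∈ Icc (s / g) b, 0 < u t - g / r * t := by
    intro t ht
    have := hcon t ht
    rw [sub_pos, div_mul_eq_mul_div, div_lt_iff₀ hr]
    linarith
  -- The excess `V = u - g t / r` satisfies `V' ≤ -2 k √V / (1 - t)`, so `√V` decreases at least as
  -- fast as `k * log (1 - t)`. Since `√V` starts at no more than `√(g / r)`, `hlog` would make it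
  -- negative at `b`.
  have hanti : AntitoneOn (fun t => √(u t - g / r * t) - k * Real.log (1 - t)) (Icc (s / g) b) := by
    have hder : ∀ t ∈ Ioo (s / g) b,
        HasDerivAt (fun t => √(u t - g / r * t) - k * Real.log (1 - t))
          ((valueDrift Φ r lam g s t (u t) / (lam * (t * (1 - t))) - g / r) /
            (2 * √(u t - g / r * t)) - k * (-1 / (1 - t))) t := by
      intro t ht
      have h1 : HasDerivAt (fun t => g / r * t) (g / r) t := by
        simpa using (hasDerivAt_id t).const_mul (g / r)
      have h2 := (h.hasDerivAt ⟨ha.trans_lt ht.1, ht.2⟩).fun_sub h1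
      have h3 : HasDerivAt (fun t : ℝ => 1 - t) (-1) t := (hasDerivAt_id t).const_sub 1
      exact (h2.sqrt (hV0 t (Ioo_subset_Icc_self ht)).ne').fun_sub
        ((h3.log (by linarith [ht.2])).const_mul k)
    apply antitoneOn_of_deriv_nonpos (convex_Icc _ _)
    · refine ContinuousOn.sub (Real.continuous_sqrt.comp_continuousOn
        ((h.continuousOn.mono hsub).sub (by fun_prop))) (continuousOn_const.mul ?_)
      exact ContinuousOn.log (by fun_prop) fun t ht => by linarith [ht.2]
    · intro t ht
      rw [interior_Icc] at ht
      exact (hder t ht).differentiableAt.differentiableWithinAt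
    · intro t ht
      rw [interior_Icc] at ht
      rw [(hder t ht).deriv]
      have ht' := Ioo_subset_Icc_self ht
      have hV := hV0 t ht'
      have ht0 : 0 < t := hsg0.trans ht.1
      have ht1 : 0 < 1 - t := by linarith [ht.2]
      have hgt : s < g * t := by
        have := ht.1
        rw [div_lt_iff₀ hg] at this
        linarith
      have hΦt := hΦκ (r * (u t - g / r * t)) (by positivity)
      have hrV : r * (u t - g / r * t) = r * u t - g * t := by field_simp
      rw [Real.sqrt_mul hr.le] at hΦt
      have hq := Real.sqrt_pos.2 hV
      set q := √(u t - g / r * t)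
      have hdrift : valueDrift Φ r lam g s t (u t) =
          t * lam * (g / r - u t) - Φ (r * (u t - g / r * t)) := by
        rw [valueDrift, max_eq_right (by linarith), max_eq_right hgt.le, hrV, sub_zero]
      have h1 : valueDrift Φ r lam g s t (u t) / (lam * (t * (1 - t))) - g / r ≤
          -(2 * k * q / (1 - t)) := by
        have hden : 0 < lam * (t * (1 - t)) := by positivity
        rw [sub_le_iff_le_add, div_le_iff₀ hden, hdrift]
        have e1 : (-(2 * k * q / (1 - t)) + g / r) * (lam * (t * (1 - t))) =
            -(t * (κ * (√r * q))) + t * lam * (g / r - g / r * t) := by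
          rw [hk]
          field_simp
        rw [e1]
        have e2 : t * (κ * (√r * q)) ≤ 1 * (κ * (√r * q)) :=
          mul_le_mul_of_nonneg_right (by linarith) (by positivity)
        have e3 : t * lam * (g / r - u t) ≤ t * lam * (g / r - g / r * t) :=
          mul_le_mul_of_nonneg_left (by linarith) (by positivity)
        linarith
      have h2 : (valueDrift Φ r lam g s t (u t) / (lam * (t * (1 - t))) - g / r) / (2 * q) ≤
          -(k / (1 - t)) := by
        rw [div_le_iff₀ (by positivity)]
        refine h1.trans (le_of_eq ?_)
        ring
      have h3 : k * (-1 / (1 - t)) = -(k / (1 - t)) := by ring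
      rw [h3]
      linarith
  have h1 := hanti ⟨le_rfl, hsb⟩ ⟨hsb, le_rfl⟩ hsb
  simp only at h1
  have h2 : √(u (s / g) - g / r * (s / g)) ≤ √(g / r) := by
    apply Real.sqrt_le_sqrt
    have := h.le_full (s / g) (hsub ⟨le_rfl, hsb⟩)
    have : 0 ≤ g / r * (s / g) := by positivity
    linarith
  have h3 := Real.sqrt_nonneg (u b - g / r * b)
  linarith

end

/-! ### The solution of the planner's equation on the unit interval -/

section

variable {Φ : ℝ → ℝ} {r lam g s : ℝ}

/-- A continuously differentiable solution `w` (with derivative `w'`) of the planner's equation on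
`(0, 1)`: it is the safe value up to `a₀` and the myopic risky value from `a₁` on. -/
structure IsBellmanSolution (Φ : ℝ → ℝ) (r lam g s a₀ a₁ : ℝ) (w w' : ℝ → ℝ) : Prop where
  a₀_pos : 0 < a₀
  a₀_lt : g * a₀ < s
  lt_a₁ : s < g * a₁
  a₁_lt : a₁ < 1
  a₀_eq : a₀ * (lam * (g - s) / r + g) = s
  continuous : Continuous w
  continuousOn_deriv : ContinuousOn w' (Ioo 0 1)
  hasDerivAt : ∀ t ∈ Ioo (0 : ℝ) 1, HasDerivAt w (w' t) t
  eq_safe : ∀ t ≤ a₀, w t = s / r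
  eq_risky : ∀ t, a₁ ≤ t → w t = g * t / r
  lt_of_mem : ∀ t ∈ Ioo a₀ a₁, max s (g * t) < r * w t
  max_le : ∀ t ∈ Ioo (0 : ℝ) 1, max s (g * t) ≤ r * w t
  le_full : ∀ t ∈ Ioo (0 : ℝ) 1, w t ≤ g / r
  deriv_nonneg : ∀ t ∈ Ioo (0 : ℝ) 1, 0 ≤ w' t
  deriv_eq_zero : ∀ t ≤ a₀, 0 < t → w' t = 0
  deriv_eq : ∀ t ∈ Ico a₀ 1, lam * (t * (1 - t)) * w' t = valueDrift Φ r lam g s t (w t)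

lemma HasDerivWithinAt.hasDerivAt_of_Iic_Ici {f : ℝ → ℝ} {f' x : ℝ}
    (h1 : HasDerivWithinAt f f' (Iic x) x) (h2 : HasDerivWithinAt f f' (Ici x) x) :
    HasDerivAt f f' x := by
  have := h1.union h2
  rwa [Iic_union_Ici, hasDerivWithinAt_univ] at this

/-- The solution on a compact interval that is stopped where it meets the myopic risky value. -/
theorem exists_stopped_solution (hΦ : IsExcessInverse Φ) (hr : 0 < r) (hlam : 0 < lam)
    (hs : 0 < s) (hsg : s < g) {a : ℝ} (ha0 : 0 < a) (ha : a * (lam * (g - s) / r + g) = s)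
    (has : a < s / g) :
    ∃ u a₁, s / g < a₁ ∧ a₁ < 1 ∧ IsValueSolution Φ r lam g s a a₁ u ∧
      r * u a₁ = g * a₁ ∧ ∀ t ∈ Ioo a a₁, max s (g * t) < r * u t := by
  have hg : 0 < g := hs.trans hsg
  have hsg1 : s / g < 1 := (div_lt_one hg).2 hsg
  obtain ⟨κ, hκ, hΦκ⟩ := hΦ.sqrt_le
  set k := κ * √r / (2 * lam) with hk
  have hk0 : 0 < k := div_pos (mul_pos hκ (Real.sqrt_pos.2 hr)) (by positivity)
  -- Chosen so that `k * ρ > √(g / r)`, where `ρ` is the drop of `log (1 - t)` between `s / g` and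
  -- `b`.
  set ρ := √(g / r) / k + 1 with hρ
  have hρ0 : 0 < ρ := by positivity
  have hexp : Real.exp (-ρ) < 1 := Real.exp_lt_one_iff.2 (neg_lt_zero.2 hρ0)
  set b := 1 - (1 - s / g) * Real.exp (-ρ) with hbdef
  have h1s : 0 < 1 - s / g := sub_pos.2 hsg1
  have hb1 : b < 1 := by
    have := mul_pos h1s (Real.exp_pos (-ρ))
    linarith
  have hsb : s / g < b := by
    have := mul_lt_mul_of_pos_left hexp h1s
    linarith
  obtain ⟨u, hu⟩ := exists_isValueSolution hΦ hr hlam hs hsg ha0 ha (has.trans hsb).le hb1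
  have hlog : √(g / r) < k * (Real.log (1 - s / g) - Real.log (1 - b)) := by
    have : 1 - b = (1 - s / g) * Real.exp (-ρ) := by rw [hbdef]; ring
    rw [this, Real.log_mul h1s.ne' (Real.exp_pos _).ne', Real.log_exp, sub_add_cancel_left,
      neg_neg, hρ, mul_add, mul_div_cancel₀ _ hk0.ne']
    linarith
  obtain ⟨t₀, ht₀, hle⟩ := hu.exists_le_risky hr hlam hs hsg hκ hΦκ has.le hb1 hsb.le hlog
  have hK : IsCompact (Icc (s / g) b ∩ (fun t => r * u t - g * t) ⁻¹' Iic 0) := by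
    refine isCompact_Icc.of_isClosed_subset (ContinuousOn.preimage_isClosed_of_isClosed ?_
      isClosed_Icc isClosed_Iic) inter_subset_left
    exact (continuousOn_const.mul (hu.continuousOn.mono (Icc_subset_Icc_left has.le))).sub
      (by fun_prop)
  -- The first contact with the risky line at or after `s / g`; minimality gives the strict
  -- inequality before it.
  obtain ⟨a₁, ⟨ha₁, hle₁⟩, hleast⟩ := hK.exists_isLeast ⟨t₀, ht₀, by
    simp only [mem_preimage, mem_Iic]
    linarith⟩
  have hle₁' : r * u a₁ ≤ g * a₁ := by
    simp only [mem_preimage, mem_Iic] at hle₁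
    linarith
  have hsafe := hu.safe_lt hΦ hr hlam hs hsg ha0 ha hb1
  have hne : s / g ≠ a₁ := by
    intro heq
    have := hsafe (s / g) ⟨has, hsb⟩
    rw [← heq, mul_div_cancel₀ s hg.ne'] at hle₁'
    rw [div_lt_iff₀ hr] at this
    linarith
  have hlt : s / g < a₁ := lt_of_le_of_ne ha₁.1 hne
  refine ⟨u, a₁, hlt, ha₁.2.trans_lt hb1, hu.mono ha₁.2, le_antisymm hle₁' ?_, fun t ht => ?_⟩
  · have := hu.risky_le a₁ ⟨has.le.trans ha₁.1, ha₁.2⟩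
    rw [div_le_iff₀ hr] at this
    linarith
  · refine max_lt ?_ ?_
    · have := hsafe t ⟨ht.1, ht.2.trans_le ha₁.2⟩
      rw [div_lt_iff₀ hr] at this
      linarith
    · rcases le_or_gt (s / g) t with hst | hst
      · by_contra hcon
        have : a₁ ≤ t := hleast ⟨⟨hst, ht.2.le.trans ha₁.2⟩, by
          simp only [mem_preimage, mem_Iic]
          linarith⟩
        linarith [ht.2]
      · have h1 := hsafe t ⟨ht.1, ht.2.trans_le ha₁.2⟩
        rw [div_lt_iff₀ hr] at h1
        rw [lt_div_iff₀ hg] at hst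
        linarith

/-- Safe value, stopped solution and risky line fit together with matching slopes: the drift
vanishes at `a₀`, and at `a₁` it gives the slope of the line. -/
theorem exists_isBellmanSolution (hΦ : IsExcessInverse Φ) (hr : 0 < r) (hlam : 0 < lam)
    (hs : 0 < s) (hsg : s < g) :
    ∃ a₀ a₁ w w', IsBellmanSolution Φ r lam g s a₀ a₁ w w' := by
  have hg : 0 < g := hs.trans hsg
  have hq : 0 < lam * (g - s) / r := div_pos (mul_pos hlam (sub_pos.2 hsg)) hr
  set a₀ := s / (lam * (g - s) / r + g) with ha₀
  have ha : a₀ * (lam * (g - s) / r + g) = s := div_mul_cancel₀ _ (by positivity)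
  have ha0 : 0 < a₀ := by positivity
  have hga : g * a₀ < s := by nlinarith
  have has : a₀ < s / g := by
    rw [lt_div_iff₀ hg]
    linarith
  obtain ⟨u, a₁, hsa₁, ha₁1, hu, hua₁, hmid⟩ := exists_stopped_solution hΦ hr hlam hs hsg ha0 ha has
  have ha₀₁ : a₀ < a₁ := has.trans hsa₁
  have hsga₁ : s < g * a₁ := by
    rw [div_lt_iff₀ hg] at hsa₁
    linarith
  have hdrift := hu.valueDrift_nonneg hΦ hr hlam hs hsg ha0 ha ha₁1
  set w : ℝ → ℝ := fun t => u (max a₀ (min t a₁)) + g / r * (max t a₁ - a₁) with hw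
  have hwlow : ∀ t ≤ a₀, w t = s / r := by
    intro t ht
    simp only [hw]
    rw [min_eq_left (ht.trans ha₀₁.le), max_eq_left ht, max_eq_right (ht.trans ha₀₁.le), hu.start]
    ring
  have hwmid : ∀ t ∈ Icc a₀ a₁, w t = u t := by
    intro t ht
    simp only [hw]
    rw [min_eq_left ht.2, max_eq_right ht.1, max_eq_right ht.2]
    ring
  have hwhigh : ∀ t, a₁ ≤ t → w t = g * t / r := by
    intro t ht
    have hu1 : u a₁ = g * a₁ / r := by
      rw [eq_div_iff hr.ne', ← hua₁]
      ring
    simp only [hw]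
    rw [min_eq_right ht, max_eq_right ha₀₁.le, max_eq_left ht, hu1]
    ring
  have hwc : Continuous w := by
    refine Continuous.add ?_ (by fun_prop)
    exact hu.continuousOn.comp_continuous (by fun_prop) fun t =>
      ⟨le_max_left _ _, max_le ha₀₁.le (min_le_right _ _)⟩
  -- One formula for the derivative on all three pieces, hence its continuity: the positive part
  -- removes the nonpositive drift up to `a₀` and changes nothing from `a₀` on.
  set w' : ℝ → ℝ := fun t => max 0 (valueDrift Φ r lam g s t (w t)) / (lam * (t * (1 - t))) with hw'
  have hden : ∀ t ∈ Ioo (0 : ℝ) 1, 0 < lam * (t * (1 - t)) := fun t ht =>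
    mul_pos hlam (mul_pos ht.1 (sub_pos.2 ht.2))
  have hdlow : ∀ t ≤ a₀, 0 < t → w' t = 0 := by
    intro t ht ht0
    have h1 : valueDrift Φ r lam g s t (w t) ≤ 0 := by
      have hgt : g * t ≤ g * a₀ := mul_le_mul_of_nonneg_left ht hg.le
      rw [hwlow t ht, valueDrift, hΦ.eq_zero, max_eq_left (by linarith)]
      · have e1 : t * lam * (g / r - s / r) = t * (lam * (g - s) / r) := by ring
        have e2 : t * (lam * (g - s) / r + g) ≤ a₀ * (lam * (g - s) / r + g) :=
          mul_le_mul_of_nonneg_right ht (by positivity)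
        rw [e1]
        linarith
      · rw [mul_div_cancel₀ s hr.ne']
        linarith [le_max_left s (g * t)]
    simp only [hw']
    rw [max_eq_left h1, zero_div]
  have hdmid : ∀ t ∈ Icc a₀ a₁, w' t = valueDrift Φ r lam g s t (u t) / (lam * (t * (1 - t))) := by
    intro t ht
    simp only [hw']
    rw [hwmid t ht, max_eq_right (hdrift t ht)]
  have hvhigh : ∀ t, a₁ ≤ t → valueDrift Φ r lam g s t (w t) = t * lam * (g / r * (1 - t)) := by
    intro t ht
    have hgt : s < g * t := hsga₁.trans_le (mul_le_mul_of_nonneg_left ht hg.le)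
    rw [hwhigh t ht, valueDrift, hΦ.eq_zero, max_eq_right (by linarith)]
    · ring
    · rw [mul_div_cancel₀ _ hr.ne']
      linarith [le_max_right s (g * t)]
  have hdhigh : ∀ t, a₁ ≤ t → t < 1 → w' t = g / r := by
    intro t ht ht1
    have ht0 : 0 < t := ha0.trans (ha₀₁.trans_le ht)
    have h1t : 0 < 1 - t := sub_pos.2 ht1
    simp only [hw']
    rw [hvhigh t ht, max_eq_right (by positivity), div_eq_iff (by positivity)]
    ring
  have hriskyder : ∀ t, HasDerivAt (fun t => g * t / r) (g / r) t := fun t => by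
    simpa using ((hasDerivAt_id t).const_mul g).div_const r
  have hder : ∀ t ∈ Ioo (0 : ℝ) 1, HasDerivAt w (w' t) t := by
    intro t ht
    have hleft : t ≤ a₀ → HasDerivWithinAt w (w' t) (Iic t) t := by
      intro h
      rw [hdlow t h ht.1]
      exact (hasDerivWithinAt_const t (Iic t) (s / r)).congr
        (fun y hy => hwlow y (le_trans hy h)) (hwlow t h)
    have hright : a₁ ≤ t → HasDerivWithinAt w (w' t) (Ici t) t := by
      intro h
      rw [hdhigh t h ht.2]
      exact (hriskyder t).hasDerivWithinAt.congr
        (fun y hy => hwhigh y (le_trans h hy)) (hwhigh t h)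
    have hmidd : t ∈ Icc a₀ a₁ → HasDerivWithinAt w (w' t) (Icc a₀ a₁) t := by
      intro h
      rw [hdmid t h]
      exact (hu.deriv t h).congr hwmid (hwmid t h)
    apply HasDerivWithinAt.hasDerivAt_of_Iic_Ici
    · rcases le_or_gt t a₀ with h | h
      · exact hleft h
      rcases le_or_gt t a₁ with h' | h'
      · exact (hmidd ⟨h.le, h'⟩).mono_of_mem_nhdsWithin (Icc_mem_nhdsLE_of_mem ⟨h, h'⟩)
      · rw [hdhigh t h'.le ht.2]
        refine ((hriskyder t).congr_of_eventuallyEq ?_).hasDerivWithinAt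
        filter_upwards [Ioi_mem_nhds h'] with y hy using hwhigh y (le_of_lt hy)
    · rcases le_or_gt a₁ t with h | h
      · exact hright h
      rcases le_or_gt a₀ t with h' | h'
      · exact (hmidd ⟨h', h.le⟩).mono_of_mem_nhdsWithin (Icc_mem_nhdsGE_of_mem ⟨h', h⟩)
      · rw [hdlow t h'.le ht.1]
        refine ((hasDerivAt_const t (s / r)).congr_of_eventuallyEq ?_).hasDerivWithinAt
        filter_upwards [Iio_mem_nhds h'] with y hy using hwlow y (le_of_lt hy)
  refine ⟨a₀, a₁, w, w', ha0, hga, hsga₁, ha₁1, ha, hwc, ?_, hder, hwlow, hwhigh, ?_, ?_, ?_, ?_,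
    hdlow, ?_⟩
  · refine ContinuousOn.div ((continuous_const.max continuous_id).comp_continuousOn
      (continuous_valueDrift hΦ continuousOn_id hwc.continuousOn))
      (Continuous.continuousOn (by fun_prop)) fun t ht => (hden t ht).ne'
  · intro t ht
    rw [hwmid t (Ioo_subset_Icc_self ht)]
    exact hmid t ht
  · intro t ht
    rcases le_or_gt t a₀ with h | h
    · rw [hwlow t h, mul_div_cancel₀ s hr.ne']
      exact max_le le_rfl ((mul_le_mul_of_nonneg_left h hg.le).trans hga.le)
    rcases le_or_gt a₁ t with h' | h'
    · rw [hwhigh t h', mul_div_cancel₀ _ hr.ne']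
      exact max_le (hsga₁.le.trans (mul_le_mul_of_nonneg_left h' hg.le)) le_rfl
    · rw [hwmid t ⟨h.le, h'.le⟩]
      exact (hmid t ⟨h, h'⟩).le
  · intro t ht
    rcases le_or_gt t a₀ with h | h
    · rw [hwlow t h]
      exact div_le_div_of_nonneg_right hsg.le hr.le
    rcases le_or_gt a₁ t with h' | h'
    · rw [hwhigh t h']
      exact div_le_div_of_nonneg_right (by nlinarith [ht.2]) hr.le
    · rw [hwmid t ⟨h.le, h'.le⟩]
      exact hu.le_full t ⟨h.le, h'.le⟩
  · exact fun t ht => div_nonneg (le_max_left _ _) (hden t ht).le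
  · intro t ht
    have ht' : t ∈ Ioo (0 : ℝ) 1 := ⟨ha0.trans_le ht.1, ht.2⟩
    simp only [hw']
    rw [mul_div_cancel₀ _ (hden t ht').ne']
    apply max_eq_right
    rcases le_or_gt a₁ t with h' | h'
    · rw [hvhigh t h']
      have : 0 < 1 - t := sub_pos.2 ht.2
      have := ht'.1
      positivity
    · rw [hwmid t ⟨ht.1, h'.le⟩]
      exact hdrift t ⟨ht.1, h'.le⟩

end

/-! ### Mechanisms and pointwise maximization -/

namespace Market

variable {M : Market}

namespace Mechanism

lemma measurable_p (m : M.Mechanism) (α : ℝ) : Measurable (m.p α) :=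
  m.p_measurable.comp measurable_prodMk_left

lemma measurable_q (m : M.Mechanism) (α : ℝ) : Measurable (m.q α) :=
  m.q_measurable.comp measurable_prodMk_left

lemma mul_mem (m : M.Mechanism) {α c : ℝ} (hα : α ∈ Ioo (0 : ℝ) 1) (hc : c ∈ Icc 0 M.cbar) :
    m.p α c * m.q α c ∈ Icc (0 : ℝ) 1 := by
  have hp := m.p_mem α hα c hc
  have hq := m.q_mem α hα c hc
  exact ⟨mul_nonneg hp.1 hq.1, mul_le_one₀ hp.2 hq.1 hq.2⟩

lemma integrable_p (m : M.Mechanism) {α : ℝ} (hα : α ∈ Ioo (0 : ℝ) 1) :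
    Integrable (m.p α) M.costLaw := by
  refine M.integrable_of_bound (m.measurable_p α) (C := 1) fun c hc => ?_
  have hp := m.p_mem α hα c (Ioo_subset_Icc_self hc)
  exact abs_le.2 ⟨by linarith [hp.1], hp.2⟩

lemma integrable_pq (m : M.Mechanism) {α : ℝ} (hα : α ∈ Ioo (0 : ℝ) 1) :
    Integrable (fun c => m.p α c * m.q α c) M.costLaw := by
  refine M.integrable_of_bound ((m.measurable_p α).mul (m.measurable_q α)) (C := 1) fun c hc => ?_
  have h := m.mul_mem hα (Ioo_subset_Icc_self hc)
  exact abs_le.2 ⟨by linarith [h.1], h.2⟩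

lemma integrable_pqc (m : M.Mechanism) {α : ℝ} (hα : α ∈ Ioo (0 : ℝ) 1) :
    Integrable (fun c => m.p α c * m.q α c * c) M.costLaw := by
  refine M.integrable_of_bound (((m.measurable_p α).mul (m.measurable_q α)).mul measurable_id)
    (C := M.cbar) fun c hc => ?_
  have h := m.mul_mem hα (Ioo_subset_Icc_self hc)
  rw [abs_of_nonneg (mul_nonneg h.1 hc.1.le)]
  nlinarith [h.1, h.2, hc.1, hc.2]

lemma integrable_flow (m : M.Mechanism) {α : ℝ} (hα : α ∈ Ioo (0 : ℝ) 1) :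
    Integrable (fun c => m.p α c * (M.lam * M.z * α) - m.p α c * m.q α c * c +
      (1 - m.p α c) * M.s) M.costLaw :=
  (((m.integrable_p hα).mul_const _).sub (m.integrable_pqc hα)).add
    (((integrable_const 1).sub (m.integrable_p hα)).mul_const _)

lemma flowSurplus_eq (m : M.Mechanism) {α : ℝ} (hα : α ∈ Ioo (0 : ℝ) 1) :
    m.flowSurplus α = M.expect (m.p α) * (M.lam * M.z * α) -
      M.expect (fun c => m.p α c * m.q α c * c) + (1 - M.expect (m.p α)) * M.s := by
  have hp := m.integrable_p hα
  have hpqc := m.integrable_pqc hα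
  simp only [flowSurplus, expect_eq]
  have hp' : Integrable (fun c => m.p α c * (M.lam * M.z * α)) M.costLaw := hp.mul_const _
  have h1p : Integrable (fun c => 1 - m.p α c) M.costLaw := (integrable_const 1).sub hp
  have hd : Integrable (fun c => m.p α c * (M.lam * M.z * α) - m.p α c * m.q α c * c)
      M.costLaw := hp'.sub hpqc
  rw [integral_add hd (h1p.mul_const _), integral_sub hp' hpqc, integral_mul_const,
    integral_mul_const, integral_sub (integrable_const 1) hp]
  simp

lemma reportProb_mem (m : M.Mechanism) {α : ℝ} (hα : α ∈ Ioo (0 : ℝ) 1) :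
    m.reportProb α ∈ Icc (0 : ℝ) 1 := by
  rw [reportProb, expect_eq]
  constructor
  · exact integral_nonneg_of_ae (M.ae_mem_Ioo.mono fun c hc =>
      (m.mul_mem hα (Ioo_subset_Icc_self hc)).1)
  · have : ∫ c, m.p α c * m.q α c ∂M.costLaw ≤ ∫ _c, (1 : ℝ) ∂M.costLaw :=
      integral_mono_ae (m.integrable_pq hα) (integrable_const 1)
        (M.ae_mem_Ioo.mono fun c hc => (m.mul_mem hα (Ioo_subset_Icc_self hc)).2)
    simpa using this

lemma abs_flowSurplus_le (m : M.Mechanism) {α : ℝ} (hα : α ∈ Ioo (0 : ℝ) 1) :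
    |m.flowSurplus α| ≤ M.lam * M.z + M.cbar + M.s := by
  have hg : 0 < M.lam * M.z := M.s_pos.trans M.s_lt
  rw [flowSurplus, expect_eq]
  have h := norm_integral_le_of_norm_le_const (μ := M.costLaw)
    (f := fun c => m.p α c * (M.lam * M.z * α) - m.p α c * m.q α c * c + (1 - m.p α c) * M.s)
    (C := M.lam * M.z + M.cbar + M.s) (M.ae_mem_Ioo.mono fun c hc => ?_)
  · simpa using h
  · have hp := m.p_mem α hα c (Ioo_subset_Icc_self hc)
    have hpq := m.mul_mem hα (Ioo_subset_Icc_self hc)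
    have h1 : 0 ≤ m.p α c * (M.lam * M.z * α) :=
      mul_nonneg hp.1 (mul_nonneg hg.le hα.1.le)
    have h2 : m.p α c * (M.lam * M.z * α) ≤ 1 * (M.lam * M.z * 1) :=
      mul_le_mul hp.2 (mul_le_mul_of_nonneg_left hα.2.le hg.le)
        (mul_nonneg hg.le hα.1.le) zero_le_one
    have h3 : 0 ≤ m.p α c * m.q α c * c := mul_nonneg hpq.1 hc.1.le
    have h4 : m.p α c * m.q α c * c ≤ 1 * M.cbar := mul_le_mul hpq.2 hc.2.le hc.1.le zero_le_one
    have h5 : 0 ≤ (1 - m.p α c) * M.s := mul_nonneg (sub_nonneg.2 hp.2) M.s_pos.le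
    have h6 : (1 - m.p α c) * M.s ≤ 1 * M.s :=
      mul_le_mul_of_nonneg_right (by linarith [hp.1]) M.s_pos.le
    have h7 := M.cbar_pos
    have h8 := M.s_pos
    rw [Real.norm_eq_abs, abs_le]
    constructor <;> linarith

lemma measurable_reportProb (m : M.Mechanism) : Measurable m.reportProb := by
  have h : StronglyMeasurable (Function.uncurry fun α c => m.p α c * m.q α c) :=
    (m.p_measurable.mul m.q_measurable).stronglyMeasurable
  have h2 := (h.integral_prod_right (ν := M.costLaw)).measurable
  convert h2 using 1
  exact funext fun α => M.expect_eq _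

lemma measurable_flowSurplus (m : M.Mechanism) : Measurable m.flowSurplus := by
  have h : StronglyMeasurable (Function.uncurry fun α c =>
      m.p α c * (M.lam * M.z * α) - m.p α c * m.q α c * c + (1 - m.p α c) * M.s) :=
    (((m.p_measurable.mul (measurable_const.mul measurable_fst)).sub
      ((m.p_measurable.mul m.q_measurable).mul measurable_snd)).add
        ((measurable_const.sub m.p_measurable).mul measurable_const)).stronglyMeasurable
  have h2 := (h.integral_prod_right (ν := M.costLaw)).measurable
  convert h2 using 1
  exact funext fun α => M.expect_eq _

/-- Pointwise maximization in the planner's problem, when a report has the net value `b`. -/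
lemma flowSurplus_add_le (m : M.Mechanism) {α : ℝ} (hα : α ∈ Ioo (0 : ℝ) 1) (b : ℝ) :
    m.flowSurplus α + m.reportProb α * b ≤
      max M.s (M.lam * M.z * α) + M.excess (b - max (M.s - M.lam * M.z * α) 0) := by
  have e1 : max M.s (M.lam * M.z * α) = ∫ _c, max M.s (M.lam * M.z * α) ∂M.costLaw := by simp
  rw [flowSurplus, reportProb, expect_eq, expect_eq, ← integral_mul_const,
    ← integral_add (m.integrable_flow hα) ((m.integrable_pq hα).mul_const b), e1, excess,
    ← integral_add (integrable_const _) (M.integrable_excess _)]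
  refine integral_mono_ae ((m.integrable_flow hα).add ((m.integrable_pq hα).mul_const b))
    ((integrable_const _).add (M.integrable_excess _)) (M.ae_mem_Ioo.mono fun c hc => ?_)
  have hp := m.p_mem α hα c (Ioo_subset_Icc_self hc)
  have hq := m.q_mem α hα c (Ioo_subset_Icc_self hc)
  have hpq := m.mul_mem hα (Ioo_subset_Icc_self hc)
  have h1 : max M.s (M.lam * M.z * α) = M.lam * M.z * α + max (M.s - M.lam * M.z * α) 0 := by
    rcases max_cases M.s (M.lam * M.z * α) with h | h <;>
      rcases max_cases (M.s - M.lam * M.z * α) 0 with h' | h' <;> linarith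
  have h2 := le_max_left M.s (M.lam * M.z * α)
  have h3 := le_max_right (M.s - M.lam * M.z * α) 0
  simp only
  -- `e` is the myopic loss from the risky product. It is incurred with probability `p`, hence at
  -- least with probability `p * q`, so each report can be charged for it.
  set e := max (M.s - M.lam * M.z * α) 0
  have h4 := le_max_left (b - e - c) 0
  have h5 := le_max_right (b - e - c) 0
  set x := max (b - e - c) 0
  rw [h1] at h2 ⊢
  have k1 : m.p α c * m.q α c * (b - e - c) ≤ m.p α c * m.q α c * x :=
    mul_le_mul_of_nonneg_left h4 hpq.1
  have k2 : m.p α c * m.q α c * x ≤ 1 * x := mul_le_mul_of_nonneg_right hpq.2 h5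
  have k3 : (1 - m.p α c) * M.s ≤ (1 - m.p α c) * (M.lam * M.z * α + e) :=
    mul_le_mul_of_nonneg_left h2 (sub_nonneg.2 hp.2)
  have k4 : m.p α c * m.q α c * e ≤ m.p α c * e :=
    mul_le_mul_of_nonneg_right (mul_le_of_le_one_right hp.1 hq.2) h3
  linarith

end Mechanism

/-- The mechanism that collects a report exactly from the agents whose cost is below the cutoff
`C α`, at beliefs above `a`, and allocates the myopically better product to the others. -/
noncomputable def cutoffMechanism (M : Market) (a : ℝ) (C : ℝ → ℝ) (hC : Measurable C) :
    M.Mechanism where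
  p α c := if α ≤ a then 0 else if M.lam * M.z * α < M.s ∧ C α ≤ c then 0 else 1
  -- Under partial coverage `q` is `1` even for agents denied the risky product: `p` alone does the
  -- selection there.
  q α c := if α ≤ a then 0 else if M.s ≤ M.lam * M.z * α ∧ C α ≤ c then 0 else 1
  t α c := if a < α ∧ c < C α then -(C α + max (M.s - M.lam * M.z * α) 0) else 0
  p_measurable := by
    have h1 : MeasurableSet {x : ℝ × ℝ | x.1 ≤ a} := measurableSet_le (by fun_prop) (by fun_prop)
    have h2 : MeasurableSet ({x : ℝ × ℝ | M.lam * M.z * x.1 < M.s} ∩ {x : ℝ × ℝ | C x.1 ≤ x.2}) :=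
      (measurableSet_lt (by fun_prop) (by fun_prop)).inter
        (measurableSet_le (by fun_prop) (by fun_prop))
    exact Measurable.ite h1 measurable_const (Measurable.ite h2 measurable_const measurable_const)
  q_measurable := by
    have h1 : MeasurableSet {x : ℝ × ℝ | x.1 ≤ a} := measurableSet_le (by fun_prop) (by fun_prop)
    have h2 : MeasurableSet ({x : ℝ × ℝ | M.s ≤ M.lam * M.z * x.1} ∩ {x : ℝ × ℝ | C x.1 ≤ x.2}) :=
      (measurableSet_le (by fun_prop) (by fun_prop)).inter
        (measurableSet_le (by fun_prop) (by fun_prop))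
    exact Measurable.ite h1 measurable_const (Measurable.ite h2 measurable_const measurable_const)
  t_measurable := by
    have h2 : MeasurableSet ({x : ℝ × ℝ | a < x.1} ∩ {x : ℝ × ℝ | x.2 < C x.1}) :=
      (measurableSet_lt (by fun_prop) (by fun_prop)).inter
        (measurableSet_lt (by fun_prop) (by fun_prop))
    exact Measurable.ite h2 (by fun_prop) measurable_const
  p_mem α _ c _ := by
    split_ifs <;> simp
  q_mem α _ c _ := by
    split_ifs <;> simp

section

variable {a : ℝ} {C : ℝ → ℝ} {hC : Measurable C}

/-- The transfer compensates reporters for the myopic loss and adds `C α`. Declaring below the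
cutoff therefore adds `C α - c` to the utility `max s (g α)`, and truth-telling takes this offer
exactly when it is profitable. -/
theorem cutoffMechanism_incentiveCompatible :
    (cutoffMechanism M a C hC).IncentiveCompatible := by
  have key : ∀ α c c', (cutoffMechanism M a C hC).agentUtility c c' α =
      if α ≤ a then M.s else max M.s (M.lam * M.z * α) + if c' < C α then C α - c else 0 := by
    intro α c c'
    simp only [Mechanism.agentUtility, cutoffMechanism]
    by_cases h1 : α ≤ a
    · simp [h1, not_lt.2 h1]
    by_cases h2 : c' < C α
    · simp only [h1, not_le.1 h1, h2, not_le.2 h2, and_self, and_false, if_true, if_false]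
      rcases max_cases M.s (M.lam * M.z * α) with h | h <;>
        rcases max_cases (M.s - M.lam * M.z * α) 0 with h' | h' <;> rw [h.1, h'.1] <;> linarith
    · by_cases h3 : M.lam * M.z * α < M.s
      · simp [h1, h2, h3, not_lt.1 h2, not_le.2 h3, max_eq_left h3.le]
      · simp [h1, h2, h3, not_lt.1 h2, not_lt.1 h3]
        ring
  intro α _ c _ c' _
  rw [key, key]
  split_ifs <;> linarith

lemma cutoffMechanism_pq {α c : ℝ} (hα : a < α) :
    (cutoffMechanism M a C hC).p α c * (cutoffMechanism M a C hC).q α c =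
      (Iio (C α)).indicator (fun _ => 1) c := by
  simp only [cutoffMechanism, not_le.2 hα, if_false, indicator, mem_Iio]
  by_cases h2 : c < C α
  · simp [h2, not_le.2 h2]
  · by_cases h3 : M.lam * M.z * α < M.s
    · simp [h2, h3, not_lt.1 h2]
    · simp [h2, h3, not_lt.1 h2, not_lt.1 h3]

lemma cutoffMechanism_reportProb {α : ℝ} (h0 : α ≤ a → C α = 0) :
    (cutoffMechanism M a C hC).reportProb α = M.probBelow (C α) := by
  rw [Mechanism.reportProb, expect_eq]
  rcases le_or_gt α a with h | h
  · simp [cutoffMechanism, h, h0 h, M.probBelow_zero]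
  · simp only [cutoffMechanism_pq h, integral_indicator_Iio, mul_one]

/-- Cutoff mechanisms solve the pointwise maximization problem. -/
lemma cutoffMechanism_flowSurplus_add {α b : ℝ} (hα : α ∈ Ioo (0 : ℝ) 1)
    (h0 : α ≤ a → M.lam * M.z * α ≤ M.s ∧ b ≤ M.s - M.lam * M.z * α)
    (h1 : a < α → C α = b - max (M.s - M.lam * M.z * α) 0) :
    (cutoffMechanism M a C hC).flowSurplus α + (cutoffMechanism M a C hC).reportProb α * b =
      max M.s (M.lam * M.z * α) + M.excess (b - max (M.s - M.lam * M.z * α) 0) := by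
  set m := cutoffMechanism M a C hC with hm
  have e1 : max M.s (M.lam * M.z * α) = ∫ _c, max M.s (M.lam * M.z * α) ∂M.costLaw := by simp
  rw [Mechanism.flowSurplus, Mechanism.reportProb, expect_eq, expect_eq, ← integral_mul_const,
    ← integral_add (m.integrable_flow hα) ((m.integrable_pq hα).mul_const b), e1, excess,
    ← integral_add (integrable_const _) (M.integrable_excess _)]
  refine integral_congr_ae (M.ae_mem_Ioo.mono fun c hc => ?_)
  simp only
  rcases le_or_gt α a with h | h
  · obtain ⟨h2, h3⟩ := h0 h
    rw [max_eq_left h2, max_eq_left (sub_nonneg.2 h2), max_eq_right (by linarith [hc.1])]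
    simp [hm, cutoffMechanism, h]
  · rw [← h1 h, hm, cutoffMechanism_pq h]
    have h4 := h1 h
    by_cases h2 : c < C α
    · rw [indicator_of_mem (mem_Iio.2 h2), max_eq_left (by linarith : (0 : ℝ) ≤ C α - c)]
      simp only [cutoffMechanism, not_le.2 h, not_le.2 h2, and_false, if_false]
      rcases max_cases M.s (M.lam * M.z * α) with h | h <;>
        rcases max_cases (M.s - M.lam * M.z * α) 0 with h' | h' <;> rw [h.1] <;>
        rw [h'.1] at h4 <;> linarith
    · rw [indicator_of_notMem (by simpa using h2), max_eq_right (by linarith : C α - c ≤ 0)]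
      by_cases h3 : M.lam * M.z * α < M.s
      · simp [cutoffMechanism, not_le.2 h, h3, not_lt.1 h2, max_eq_left h3.le]
      · simp [cutoffMechanism, not_le.2 h, h3, max_eq_right (not_lt.1 h3)]

end

end Market

/-! ### Reporting cutoffs derived from the value -/

/-- Net value of one more report, given a value function `w` with derivative `w'`. -/
noncomputable def reportValue (r lam g : ℝ) (w w' : ℝ → ℝ) (α : ℝ) : ℝ :=
  α * lam * g / r - α * (1 - α) * lam * w' α - lam * α * w α

/-- Cost below which agents report, given a value function `w`. -/
noncomputable def reportCutoff (Φ : ℝ → ℝ) (r g s : ℝ) (w : ℝ → ℝ) (α : ℝ) : ℝ :=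
  Φ (r * w α - max s (g * α))

namespace IsBellmanSolution

variable {Φ : ℝ → ℝ} {r lam g s a₀ a₁ : ℝ} {w w' : ℝ → ℝ}

lemma continuous_reportCutoff (hw : IsBellmanSolution Φ r lam g s a₀ a₁ w w')
    (hΦ : IsExcessInverse Φ) : Continuous (reportCutoff Φ r g s w) := by
  have h1 := hw.continuous
  have h2 := hΦ.continuous
  unfold reportCutoff
  fun_prop

/-- This is the value equation solved for its `Φ` term: the cutoff is the net value of a report
minus the myopic loss. -/
lemma reportCutoff_eq (hw : IsBellmanSolution Φ r lam g s a₀ a₁ w w') {α : ℝ}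
    (hα : α ∈ Ico a₀ 1) :
    reportCutoff Φ r g s w α = reportValue r lam g w w' α - max (s - g * α) 0 := by
  have h := hw.deriv_eq α hα
  rw [valueDrift] at h
  rw [reportCutoff, reportValue]
  linear_combination h

/-- With `w` constant at `s / r`, the value of a report and the myopic loss are linear in the belief
and cross at `a₀`. -/
lemma reportValue_le (hw : IsBellmanSolution Φ r lam g s a₀ a₁ w w') (hr : 0 < r) (hlam : 0 < lam)
    (hs : 0 < s) (hsg : s < g) {α : ℝ} (hα : α ∈ Ioo 0 a₀) :
    g * α ≤ s ∧ reportValue r lam g w w' α ≤ s - g * α := by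
  have hg : 0 < g := hs.trans hsg
  have hq : 0 < lam * (g - s) / r := div_pos (mul_pos hlam (sub_pos.2 hsg)) hr
  have h1 : g * α ≤ g * a₀ := mul_le_mul_of_nonneg_left hα.2.le hg.le
  refine ⟨h1.trans hw.a₀_lt.le, ?_⟩
  rw [reportValue, hw.deriv_eq_zero α hα.2.le hα.1, hw.eq_safe α hα.2.le]
  have h2 : α * (lam * (g - s) / r + g) ≤ a₀ * (lam * (g - s) / r + g) :=
    mul_le_mul_of_nonneg_right hα.2.le (by positivity)
  rw [hw.a₀_eq] at h2
  have h3 : α * lam * g / r - α * (1 - α) * lam * 0 - lam * α * (s / r) =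
      α * (lam * (g - s) / r) := by ring
  rw [h3]
  linarith

lemma reportCutoff_eq_zero_of_le (hw : IsBellmanSolution Φ r lam g s a₀ a₁ w w')
    (hΦ : IsExcessInverse Φ) (hr : 0 < r) {α : ℝ} (hα : α ≤ a₀) :
    reportCutoff Φ r g s w α = 0 := by
  rw [reportCutoff, hw.eq_safe α hα, mul_div_cancel₀ s hr.ne']
  exact hΦ.eq_zero _ (by linarith [le_max_left s (g * α)])

lemma reportCutoff_eq_zero_of_ge (hw : IsBellmanSolution Φ r lam g s a₀ a₁ w w')
    (hΦ : IsExcessInverse Φ) (hr : 0 < r) {α : ℝ} (hα : a₁ ≤ α) :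
    reportCutoff Φ r g s w α = 0 := by
  rw [reportCutoff, hw.eq_risky α hα, mul_div_cancel₀ _ hr.ne']
  exact hΦ.eq_zero _ (by linarith [le_max_right s (g * α)])

lemma reportCutoff_pos (hw : IsBellmanSolution Φ r lam g s a₀ a₁ w w') (hΦ : IsExcessInverse Φ)
    {α : ℝ} (hα : α ∈ Ioo a₀ a₁) : 0 < reportCutoff Φ r g s w α :=
  hΦ.pos _ (sub_pos.2 (hw.lt_of_mem α hα))

/-- Dropping the nonnegative slope and using `w ≥ s / r` can only raise the value of a report. -/
lemma reportCutoff_le (hw : IsBellmanSolution Φ r lam g s a₀ a₁ w w') (hr : 0 < r)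
    (hlam : 0 < lam) {α : ℝ} (hα : α ∈ Ico a₀ 1) :
    reportCutoff Φ r g s w α ≤ α * (lam * (g - s) / r) - max (s - g * α) 0 := by
  have hα' : α ∈ Ioo (0 : ℝ) 1 := ⟨hw.a₀_pos.trans_le hα.1, hα.2⟩
  rw [hw.reportCutoff_eq hα, reportValue]
  have h1 : 0 ≤ α * (1 - α) * lam * w' α :=
    mul_nonneg (mul_nonneg (mul_nonneg hα'.1.le (sub_nonneg.2 hα.2.le)) hlam.le)
      (hw.deriv_nonneg α hα')
  have h2 : s / r ≤ w α := by
    rw [div_le_iff₀ hr]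
    linarith [hw.max_le α hα', le_max_left s (g * α)]
  have h3 : lam * α * (s / r) ≤ lam * α * w α :=
    mul_le_mul_of_nonneg_left h2 (mul_nonneg hlam.le hα'.1.le)
  have h4 : α * (lam * (g - s) / r) = α * lam * g / r - lam * α * (s / r) := by ring
  rw [h4]
  linarith

/-- The linear vanishing at `a₀` keeps the belief from reaching `a₀` in finite time. -/
lemma reportCutoff_le_mul (hw : IsBellmanSolution Φ r lam g s a₀ a₁ w w') (hr : 0 < r)
    (hlam : 0 < lam) {α : ℝ} (hα : α ∈ Ico a₀ 1) :
    reportCutoff Φ r g s w α ≤ (lam * (g - s) / r + g) * (α - a₀) := by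
  have h1 := hw.reportCutoff_le hr hlam hα
  have h2 := le_max_left (s - g * α) 0
  have h3 := hw.a₀_eq
  linarith

/-- The planner's dynamic programming equation. -/
lemma bellman {M : Market} (hw : IsBellmanSolution Φ M.r M.lam (M.lam * M.z) M.s a₀ a₁ w w')
    (hinv : ∀ x, 0 ≤ x → M.excess (Φ x) = x) {α : ℝ} (hα : α ∈ Ioo (0 : ℝ) 1) :
    max M.s (M.lam * M.z * α) + M.excess (reportValue M.r M.lam (M.lam * M.z) w w' α -
      max (M.s - M.lam * M.z * α) 0) = M.r * w α := by
  rcases lt_or_ge α a₀ with h | h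
  · obtain ⟨h1, h2⟩ := hw.reportValue_le M.r_pos M.lam_pos M.s_pos M.s_lt ⟨hα.1, h⟩
    rw [M.excess_of_nonpos (by linarith [le_max_left (M.s - M.lam * M.z * α) 0]), max_eq_left h1,
      hw.eq_safe α h.le, mul_div_cancel₀ _ M.r_pos.ne', add_zero]
  · rw [← hw.reportCutoff_eq ⟨h, hα.2⟩, reportCutoff, hinv _ (sub_nonneg.2 (hw.max_le α hα))]
    ring

end IsBellmanSolution

/-! ### Belief paths and verification -/

/-- Belief after the amount `x` of reported experimentation without news. -/
noncomputable def posterior (lam α₀ x : ℝ) : ℝ :=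
  α₀ * Real.exp (-(lam * x)) / (α₀ * Real.exp (-(lam * x)) + (1 - α₀))

lemma posterior_mem {lam α₀ : ℝ} (hα₀ : α₀ ∈ Ioo (0 : ℝ) 1) (x : ℝ) :
    posterior lam α₀ x ∈ Ioo (0 : ℝ) 1 := by
  have h1 : 0 < α₀ * Real.exp (-(lam * x)) := mul_pos hα₀.1 (Real.exp_pos _)
  have h2 : 0 < 1 - α₀ := sub_pos.2 hα₀.2
  exact ⟨by unfold posterior; positivity, (div_lt_one (by positivity)).2 (by linarith)⟩

lemma hasDerivAt_exp_neg_mul (lam α₀ x : ℝ) :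
    HasDerivAt (fun x => α₀ * Real.exp (-(lam * x))) (-lam * (α₀ * Real.exp (-(lam * x)))) x := by
  have h := ((((hasDerivAt_id x).const_mul lam).neg).exp).const_mul α₀
  refine h.congr_deriv ?_
  simp only [id, Pi.neg_apply]
  ring

lemma hasDerivAt_posterior {lam α₀ : ℝ} (hα₀ : α₀ ∈ Ioo (0 : ℝ) 1) (x : ℝ) :
    HasDerivAt (posterior lam α₀) (-lam * (posterior lam α₀ x * (1 - posterior lam α₀ x))) x := by
  have h1 : 0 < α₀ * Real.exp (-(lam * x)) := mul_pos hα₀.1 (Real.exp_pos _)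
  have h2 : 0 < 1 - α₀ := sub_pos.2 hα₀.2
  have hE := hasDerivAt_exp_neg_mul lam α₀ x
  have h := hE.fun_div (hE.add_const (1 - α₀)) (by positivity)
  refine h.congr_deriv ?_
  unfold posterior
  have h3 : α₀ * Real.exp (-(lam * x)) + (1 - α₀) ≠ 0 := by positivity
  field_simp
  ring

namespace Market

variable {M : Market} {Φ : ℝ → ℝ} {a₀ a₁ : ℝ} {w w' : ℝ → ℝ}

namespace Mechanism

lemma IsBeliefPath.eq_posterior {m : M.Mechanism} {α₀ : ℝ} {a : ℝ → ℝ}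
    (ha : m.IsBeliefPath α₀ a) {τ : ℝ} (hτ : 0 ≤ τ) :
    a τ = posterior M.lam α₀ (m.experience a τ) := ha.bayes τ hτ

lemma IsBeliefPath.mem {m : M.Mechanism} {α₀ : ℝ} {a : ℝ → ℝ} (ha : m.IsBeliefPath α₀ a)
    (hα₀ : α₀ ∈ Ioo (0 : ℝ) 1) {τ : ℝ} (hτ : 0 ≤ τ) : a τ ∈ Ioo (0 : ℝ) 1 := by
  rw [ha.eq_posterior hτ]
  exact posterior_mem hα₀ _

lemma IsBeliefPath.intervalIntegrable {m : M.Mechanism} {α₀ : ℝ} {a : ℝ → ℝ}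
    (ha : m.IsBeliefPath α₀ a) (hα₀ : α₀ ∈ Ioo (0 : ℝ) 1) {T : ℝ} (hT : 0 ≤ T) :
    IntervalIntegrable (fun u => m.reportProb (a u)) volume 0 T := by
  rw [intervalIntegrable_iff_integrableOn_Ioc_of_le hT]
  have hsub : Ioc 0 T ⊆ Ici 0 := fun u hu => hu.1.le
  have hm : AEMeasurable (fun u => m.reportProb (a u)) (volume.restrict (Ioc 0 T)) :=
    m.measurable_reportProb.comp_aemeasurable
      ((ha.continuousOn.mono hsub).aemeasurable measurableSet_Ioc)
  refine Integrable.of_bound hm.aestronglyMeasurable 1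
    ((ae_restrict_mem measurableSet_Ioc).mono fun u hu => ?_)
  have := m.reportProb_mem (ha.mem hα₀ (hsub hu))
  exact abs_le.2 ⟨by linarith [this.1], this.2⟩

lemma IsBeliefPath.experience_nonneg {m : M.Mechanism} {α₀ : ℝ} {a : ℝ → ℝ}
    (ha : m.IsBeliefPath α₀ a) (hα₀ : α₀ ∈ Ioo (0 : ℝ) 1) {τ : ℝ} (hτ : 0 ≤ τ) :
    0 ≤ m.experience a τ :=
  intervalIntegral.integral_nonneg hτ fun _ hu => (m.reportProb_mem (ha.mem hα₀ hu.1)).1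

lemma IsBeliefPath.noNewsProb_mem {m : M.Mechanism} {α₀ : ℝ} {a : ℝ → ℝ}
    (ha : m.IsBeliefPath α₀ a) (hα₀ : α₀ ∈ Ioo (0 : ℝ) 1) {τ : ℝ} (hτ : 0 ≤ τ) :
    m.noNewsProb α₀ a τ ∈ Icc (0 : ℝ) 1 := by
  have h1 : Real.exp (-(M.lam * m.experience a τ)) ≤ 1 := Real.exp_le_one_iff.2
    (neg_nonpos.2 (mul_nonneg M.lam_pos.le (ha.experience_nonneg hα₀ hτ)))
  have h2 := Real.exp_pos (-(M.lam * m.experience a τ))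
  have h3 := hα₀.1
  have h4 := hα₀.2
  rw [noNewsProb]
  constructor <;> nlinarith

lemma IsBeliefPath.continuousOn_experience {m : M.Mechanism} {α₀ : ℝ} {a : ℝ → ℝ}
    (ha : m.IsBeliefPath α₀ a) (hα₀ : α₀ ∈ Ioo (0 : ℝ) 1) :
    ContinuousOn (m.experience a) (Ici 0) := by
  intro τ hτ
  have hτ0 : (0 : ℝ) ≤ τ := hτ
  have hi := ha.intervalIntegrable hα₀ (T := τ + 1) (by linarith)
  have hc := intervalIntegral.continuousOn_primitive_interval
    (μ := volume) (f := fun u => m.reportProb (a u)) (a := 0) (b := τ + 1)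
    ((intervalIntegrable_iff' (by simp)).1 hi)
  rw [uIcc_of_le (by linarith)] at hc
  refine (hc τ ⟨hτ0, by linarith⟩).mono_of_mem_nhdsWithin ?_
  have : Iio (τ + 1) ∩ Ici 0 ∈ 𝓝[Ici 0] τ :=
    inter_mem (mem_nhdsWithin_of_mem_nhds (Iio_mem_nhds (by linarith))) self_mem_nhdsWithin
  exact mem_of_superset this fun y hy => ⟨hy.2, le_of_lt hy.1⟩

/-- The integrand of welfare. -/
noncomputable def welfareRate (m : M.Mechanism) (α₀ : ℝ) (a : ℝ → ℝ) (τ : ℝ) : ℝ :=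
  Real.exp (-(M.r * τ)) * m.noNewsProb α₀ a τ *
    (m.flowSurplus (a τ) + M.lam * a τ * m.reportProb (a τ) * (M.lam * M.z / M.r))

lemma IsBeliefPath.integrableOn_welfareRate {m : M.Mechanism} {α₀ : ℝ} {a : ℝ → ℝ}
    (ha : m.IsBeliefPath α₀ a) (hα₀ : α₀ ∈ Ioo (0 : ℝ) 1) :
    IntegrableOn (m.welfareRate α₀ a) (Ioi 0) := by
  have hg : 0 < M.lam * M.z := M.s_pos.trans M.s_lt
  have hsub : Ioi (0 : ℝ) ⊆ Ici 0 := Ioi_subset_Ici_self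
  have ham : AEMeasurable a (volume.restrict (Ioi 0)) :=
    (ha.continuousOn.mono hsub).aemeasurable measurableSet_Ioi
  have hxm : AEMeasurable (m.experience a) (volume.restrict (Ioi 0)) :=
    ((ha.continuousOn_experience hα₀).mono hsub).aemeasurable measurableSet_Ioi
  have hflow := m.measurable_flowSurplus.comp_aemeasurable ham
  have hrep := m.measurable_reportProb.comp_aemeasurable ham
  have hsur : AEMeasurable (m.noNewsProb α₀ a) (volume.restrict (Ioi 0)) := by
    unfold noNewsProb
    exact ((Real.measurable_exp.comp_aemeasurable (hxm.const_mul M.lam).neg).const_mul α₀).add_const _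
  have hmeas : AEMeasurable (m.welfareRate α₀ a) (volume.restrict (Ioi 0)) := by
    unfold welfareRate
    refine AEMeasurable.mul (AEMeasurable.mul (by fun_prop) hsur) (hflow.add ?_)
    exact ((ham.const_mul M.lam).mul hrep).mul_const _
  set E := M.lam * M.z + M.cbar + M.s + M.lam * (M.lam * M.z / M.r) with hE
  have hexp : IntegrableOn (fun τ : ℝ => E * Real.exp (-M.r * τ)) (Ioi 0) :=
    (exp_neg_integrableOn_Ioi 0 M.r_pos).const_mul E
  refine Integrable.mono' hexp hmeas.aestronglyMeasurable
    ((ae_restrict_mem measurableSet_Ioi).mono fun τ hτ => ?_)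
  have hτ' : (0 : ℝ) ≤ τ := le_of_lt hτ
  have h1 := ha.mem hα₀ hτ'
  have h2 := m.abs_flowSurplus_le h1
  have h3 := m.reportProb_mem h1
  have h4 := ha.noNewsProb_mem hα₀ hτ'
  have hgr : 0 ≤ M.lam * M.z / M.r := div_nonneg hg.le M.r_pos.le
  have h5 : 0 ≤ M.lam * a τ * m.reportProb (a τ) :=
    mul_nonneg (mul_nonneg M.lam_pos.le h1.1.le) h3.1
  have h6 : M.lam * a τ * m.reportProb (a τ) ≤ M.lam := by
    have : a τ * m.reportProb (a τ) ≤ 1 := mul_le_one₀ h1.2.le h3.1 h3.2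
    nlinarith [M.lam_pos]
  have h7 : |m.flowSurplus (a τ) + M.lam * a τ * m.reportProb (a τ) * (M.lam * M.z / M.r)| ≤ E := by
    refine (abs_add_le _ _).trans ?_
    rw [abs_of_nonneg (mul_nonneg h5 hgr)]
    exact add_le_add h2 (mul_le_mul_of_nonneg_right h6 hgr)
  rw [welfareRate, Real.norm_eq_abs, abs_mul, abs_mul, abs_of_pos (Real.exp_pos _),
    abs_of_nonneg h4.1, neg_mul]
  calc _ ≤ Real.exp (-(M.r * τ)) * 1 * E :=
        mul_le_mul (mul_le_mul_of_nonneg_left h4.2 (Real.exp_pos _).le) h7 (abs_nonneg _)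
          (by positivity)
    _ = E * Real.exp (-(M.r * τ)) := by ring

/-- Verification: welfare is bounded by a solution of the dynamic programming equation, with
equality if the mechanism solves the pointwise maximization problem. -/
theorem IsBeliefPath.welfare_le (hw : IsBellmanSolution Φ M.r M.lam (M.lam * M.z) M.s a₀ a₁ w w')
    (hinv : ∀ x, 0 ≤ x → M.excess (Φ x) = x) {m : M.Mechanism} {α₀ : ℝ} {a : ℝ → ℝ}
    (ha : m.IsBeliefPath α₀ a) (hα₀ : α₀ ∈ Ioo (0 : ℝ) 1) :
    m.welfare α₀ a ≤ w α₀ ∧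
    ((∀ α ∈ Ioo (0 : ℝ) 1, m.flowSurplus α +
      m.reportProb α * reportValue M.r M.lam (M.lam * M.z) w w' α = M.r * w α) →
      m.welfare α₀ a = w α₀) := by
  set P := posterior M.lam α₀ with hP
  -- No-news probability times candidate value. In terms of accumulated experience it is `C¹`,
  -- although the path need not be differentiable in time.
  set φ : ℝ → ℝ := fun x => (α₀ * Real.exp (-(M.lam * x)) + (1 - α₀)) * w (P x) with hφdef
  set φ' : ℝ → ℝ := fun x => (α₀ * Real.exp (-(M.lam * x)) + (1 - α₀)) *
    (-(M.lam * P x * w (P x)) - M.lam * (P x * (1 - P x)) * w' (P x)) with hφ'def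
  have hPmem := fun x => posterior_mem (lam := M.lam) hα₀ x
  have hS : ∀ x, 0 < α₀ * Real.exp (-(M.lam * x)) + (1 - α₀) := fun x =>
    add_pos (mul_pos hα₀.1 (Real.exp_pos _)) (sub_pos.2 hα₀.2)
  have hPd := fun x => hasDerivAt_posterior (lam := M.lam) hα₀ x
  have hPc : Continuous P := continuous_iff_continuousAt.2 fun x => (hPd x).continuousAt
  have hφ : ∀ x, HasDerivAt φ (φ' x) x := by
    intro x
    have h1 := (hasDerivAt_exp_neg_mul M.lam α₀ x).add_const (1 - α₀)
    have h2 := (hw.hasDerivAt _ (hPmem x)).comp x (hPd x)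
    refine (h1.fun_mul h2).congr_deriv ?_
    have h3 : α₀ * Real.exp (-(M.lam * x)) =
        (α₀ * Real.exp (-(M.lam * x)) + (1 - α₀)) * P x :=
      (mul_div_cancel₀ _ (hS x).ne').symm
    simp only [hφ'def, Function.comp]
    linear_combination (-M.lam * w (P x)) * h3
  have hφ' : Continuous φ' := by
    have h1 : Continuous fun x => w' (P x) := hw.continuousOn_deriv.comp_continuous hPc hPmem
    have h2 : Continuous fun x => w (P x) := hw.continuous.comp hPc
    refine Continuous.mul (by fun_prop) (Continuous.sub ?_ ?_)
    · exact ((continuous_const.mul hPc).mul h2).neg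
    · exact (continuous_const.mul (hPc.mul (continuous_const.sub hPc))).mul h1
  have hφc : Continuous φ := continuous_iff_continuousAt.2 fun x => (hφ x).continuousAt
  set X := m.experience a with hX
  have hI := ha.integrableOn_welfareRate hα₀
  have hlim := intervalIntegral_tendsto_integral_Ioi 0 hI tendsto_id
  change Tendsto _ _ (𝓝 (m.welfare α₀ a)) at hlim
  have hφ0 : φ 0 = w α₀ := by
    simp [hφdef, hP, posterior]
  have hww : ∀ x, 0 ≤ w (P x) := fun x => by
    have := hw.max_le _ (hPmem x)
    have h2 := le_max_left M.s (M.lam * M.z * P x)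
    have h3 : 0 ≤ M.r * w (P x) := by linarith [M.s_pos]
    exact nonneg_of_mul_nonneg_right h3 M.r_pos
  have hftc : ∀ T, 0 ≤ T → ∫ τ in (0 : ℝ)..T, Real.exp (-(M.r * τ)) *
      (φ' (X τ) * m.reportProb (a τ) - M.r * φ (X τ)) =
        Real.exp (-(M.r * T)) * φ (X T) - w α₀ := by
    intro T hT
    rw [← hφ0]
    exact integral_exp_mul_comp_integral hT hφ hφ' (ha.intervalIntegrable hα₀ hT) fun u hu =>
      abs_le.2 ⟨by linarith [(m.reportProb_mem (ha.mem hα₀ hu.1)).1],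
        (m.reportProb_mem (ha.mem hα₀ hu.1)).2⟩
  have hJint : ∀ T, 0 ≤ T → IntervalIntegrable (fun τ => Real.exp (-(M.r * τ)) *
      (φ' (X τ) * m.reportProb (a τ) - M.r * φ (X τ))) volume 0 T := by
    intro T hT
    have hXc : ContinuousOn X (uIcc 0 T) := (ha.continuousOn_experience hα₀).mono (by
      rw [uIcc_of_le hT]
      exact Icc_subset_Ici_self)
    refine IntervalIntegrable.continuousOn_mul (IntervalIntegrable.sub
      ((ha.intervalIntegrable hα₀ hT).continuousOn_mul (hφ'.comp_continuousOn hXc)) ?_)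
      (Continuous.continuousOn (by fun_prop))
    exact (continuousOn_const.mul (hφc.comp_continuousOn hXc)).intervalIntegrable
  have hIint : ∀ T, 0 ≤ T → IntervalIntegrable (m.welfareRate α₀ a) volume 0 T := fun T hT => by
    rw [intervalIntegrable_iff_integrableOn_Ioc_of_le hT]
    exact hI.mono_set Ioc_subset_Ioi_self
  -- The welfare rate is minus the total derivative of the discounted `φ (X τ)` plus a weighted
  -- Bellman gap. The gap is never positive, and it is zero for pointwise maximizers.
  have hsum : ∀ τ, 0 ≤ τ → m.welfareRate α₀ a τ = -(Real.exp (-(M.r * τ)) *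
      (φ' (X τ) * m.reportProb (a τ) - M.r * φ (X τ))) +
      Real.exp (-(M.r * τ)) * (α₀ * Real.exp (-(M.lam * X τ)) + (1 - α₀)) *
        (m.flowSurplus (a τ) + m.reportProb (a τ) *
          reportValue M.r M.lam (M.lam * M.z) w w' (a τ) - M.r * w (a τ)) := by
    intro τ hτ
    have h1 : a τ = P (X τ) := ha.eq_posterior hτ
    simp only [welfareRate, noNewsProb, hφdef, hφ'def, reportValue, ← h1]
    ring
  constructor
  · refine le_of_tendsto hlim ?_
    filter_upwards [eventually_ge_atTop 0] with T hT
    have h1 : ∫ τ in (0 : ℝ)..T, m.welfareRate α₀ a τ ≤ ∫ τ in (0 : ℝ)..T,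
        -(Real.exp (-(M.r * τ)) * (φ' (X τ) * m.reportProb (a τ) - M.r * φ (X τ))) := by
      refine intervalIntegral.integral_mono_on hT (hIint T hT) (hJint T hT).neg fun τ hτ => ?_
      rw [hsum τ hτ.1]
      have h2 := m.flowSurplus_add_le (ha.mem hα₀ hτ.1)
        (reportValue M.r M.lam (M.lam * M.z) w w' (a τ))
      rw [hw.bellman hinv (ha.mem hα₀ hτ.1)] at h2
      have h3 : 0 ≤ Real.exp (-(M.r * τ)) * (α₀ * Real.exp (-(M.lam * X τ)) + (1 - α₀)) :=
        mul_nonneg (Real.exp_pos _).le (hS _).le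
      have h4 := mul_nonpos_of_nonneg_of_nonpos h3 (sub_nonpos.2 h2)
      linarith
    rw [intervalIntegral.integral_neg, hftc T hT] at h1
    have h2 : 0 ≤ Real.exp (-(M.r * T)) * φ (X T) :=
      mul_nonneg (Real.exp_pos _).le (mul_nonneg (hS _).le (hww _))
    simp only [id]
    linarith
  · intro heq
    refine tendsto_nhds_unique hlim ?_
    -- Transversality: `φ (X T)` stays in `[0, g / r]`, so discounting removes the terminal term.
    have hlim2 : Tendsto (fun T => w α₀ - Real.exp (-(M.r * T)) * φ (X T)) atTop (𝓝 (w α₀)) := by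
      have h0 : Tendsto (fun T => Real.exp (-(M.r * T)) * (M.lam * M.z / M.r)) atTop (𝓝 0) := by
        have h1 : Tendsto (fun T => Real.exp (-(M.r * T))) atTop (𝓝 0) :=
          Real.tendsto_exp_neg_atTop_nhds_zero.comp (tendsto_id.const_mul_atTop M.r_pos)
        simpa using h1.mul_const (M.lam * M.z / M.r)
      have h2 : Tendsto (fun T => Real.exp (-(M.r * T)) * φ (X T)) atTop (𝓝 0) := by
        refine tendsto_of_tendsto_of_tendsto_of_le_of_le' tendsto_const_nhds h0 ?_ ?_
        · exact Eventually.of_forall fun T =>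
            mul_nonneg (Real.exp_pos _).le (mul_nonneg (hS _).le (hww _))
        · filter_upwards [eventually_ge_atTop 0] with T hT
          refine mul_le_mul_of_nonneg_left ?_ (Real.exp_pos _).le
          have h3 := (ha.noNewsProb_mem hα₀ hT).2
          have h4 := hw.le_full _ (hPmem (X T))
          calc φ (X T) ≤ 1 * w (P (X T)) := mul_le_mul_of_nonneg_right h3 (hww _)
            _ ≤ _ := by linarith
      simpa using h2.const_sub (w α₀)
    refine hlim2.congr' ?_
    filter_upwards [eventually_ge_atTop 0] with T hT
    have h1 : ∫ τ in (0 : ℝ)..T, m.welfareRate α₀ a τ = ∫ τ in (0 : ℝ)..T,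
        -(Real.exp (-(M.r * τ)) * (φ' (X τ) * m.reportProb (a τ) - M.r * φ (X τ))) := by
      refine intervalIntegral.integral_congr fun τ hτ => ?_
      rw [uIcc_of_le hT] at hτ
      rw [hsum τ hτ.1, heq _ (ha.mem hα₀ hτ.1), sub_self, mul_zero, add_zero]
    rw [intervalIntegral.integral_neg, hftc T hT] at h1
    change _ = ∫ τ in (0 : ℝ)..T, m.welfareRate α₀ a τ
    rw [h1]
    ring

end Mechanism

end Market

/-! ### Existence of belief paths for the cutoff mechanism -/

namespace Market

variable {M : Market} {Φ : ℝ → ℝ} {a₀ a₁ : ℝ} {w w' : ℝ → ℝ}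

namespace Mechanism

lemma isBeliefPath_const {m : M.Mechanism} {α₀ : ℝ} (h : m.reportProb α₀ = 0) :
    m.IsBeliefPath α₀ fun _ => α₀ where
  continuousOn := continuousOn_const
  bayes τ _ := by simp [experience, noNewsProb, h]

/-- A differentiable path that solves the belief equation obeys Bayes' rule. -/
lemma isBeliefPath_of_hasDerivAt {m : M.Mechanism} {a ξ : ℝ → ℝ}
    (hmem : ∀ τ, 0 ≤ τ → a τ ∈ Ioo (0 : ℝ) 1) (hξ : Continuous ξ)
    (hrep : ∀ τ, 0 ≤ τ → m.reportProb (a τ) = ξ τ)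
    (hd : ∀ τ, 0 ≤ τ → HasDerivAt a (-(M.lam * (a τ * (1 - a τ) * ξ τ))) τ) :
    m.IsBeliefPath (a 0) a where
  continuousOn τ hτ := (hd τ hτ).continuousAt.continuousWithinAt
  bayes τ hτ := by
    have hexp : m.experience a τ = ∫ u in (0 : ℝ)..τ, ξ u := by
      refine intervalIntegral.integral_congr fun u hu => ?_
      rw [uIcc_of_le hτ] at hu
      exact hrep u hu.1
    -- The log-odds fall at rate `lam * ξ`; integrating this is Bayes' rule.
    have hlog : ∀ u ∈ uIcc 0 τ,
        HasDerivAt (fun u => Real.log (a u) - Real.log (1 - a u)) (-M.lam * ξ u) u := by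
      intro u hu
      rw [uIcc_of_le hτ] at hu
      have h1 := (hmem u hu.1).1
      have h2 : 0 < 1 - a u := sub_pos.2 (hmem u hu.1).2
      refine (((hd u hu.1).log h1.ne').fun_sub (((hd u hu.1).const_sub 1).log h2.ne')).congr_deriv ?_
      field_simp
      ring
    have hftc := intervalIntegral.integral_eq_sub_of_hasDerivAt hlog
      ((continuous_const.mul hξ).intervalIntegrable 0 τ)
    rw [intervalIntegral.integral_const_mul, ← hexp] at hftc
    have h0 := (hmem 0 le_rfl).1
    have h0' : 0 < 1 - a 0 := sub_pos.2 (hmem 0 le_rfl).2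
    have hτ0 := (hmem τ hτ).1
    have hτ1 : 0 < 1 - a τ := sub_pos.2 (hmem τ hτ).2
    have hE : Real.exp (-(M.lam * m.experience a τ)) = a τ / (1 - a τ) / (a 0 / (1 - a 0)) := by
      rw [← Real.exp_log (show 0 < a τ / (1 - a τ) / (a 0 / (1 - a 0)) by positivity),
        Real.log_div (by positivity) (by positivity), Real.log_div hτ0.ne' hτ1.ne',
        Real.log_div h0.ne' h0'.ne', ← hftc, neg_mul]
    rw [noNewsProb, hE]
    field_simp
    ring

end Mechanism

/-- The optimal cutoff mechanism generates a belief path from every initial belief. -/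
theorem exists_isBeliefPath_cutoffMechanism
    (hw : IsBellmanSolution Φ M.r M.lam (M.lam * M.z) M.s a₀ a₁ w w') (hΦ : IsExcessInverse Φ)
    {α₀ : ℝ} (hα₀ : α₀ ∈ Ioo (0 : ℝ) 1)
    {hC : Measurable (reportCutoff Φ M.r (M.lam * M.z) M.s w)} :
    ∃ a, (cutoffMechanism M a₀ (reportCutoff Φ M.r (M.lam * M.z) M.s w) hC).IsBeliefPath α₀ a := by
  set C := reportCutoff Φ M.r (M.lam * M.z) M.s w with hCdef
  set m := cutoffMechanism M a₀ C hC
  have hrep : ∀ α, m.reportProb α = M.probBelow (C α) := fun α =>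
    cutoffMechanism_reportProb fun h => hw.reportCutoff_eq_zero_of_le hΦ M.r_pos h
  rcases le_or_gt α₀ a₀ with h | h
  · refine ⟨_, Mechanism.isBeliefPath_const ?_⟩
    rw [hrep, hCdef, hw.reportCutoff_eq_zero_of_le hΦ M.r_pos h, M.probBelow_zero]
  rcases le_or_gt a₁ α₀ with h' | h'
  · refine ⟨_, Mechanism.isBeliefPath_const ?_⟩
    rw [hrep, hCdef, hw.reportCutoff_eq_zero_of_ge hΦ M.r_pos h', M.probBelow_zero]
  have hg : 0 < M.lam * M.z := M.s_pos.trans M.s_lt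
  have hlam := M.lam_pos
  obtain ⟨K, hK, hKle⟩ := M.exists_probBelow_le
  have hCc : Continuous C := hw.continuous_reportCutoff hΦ
  set k := M.lam * (M.lam * M.z - M.s) / M.r + M.lam * M.z with hk
  -- The coordinate `v` sends `a₀` to infinity: the belief is `A v`, and it must fall from `α₀`
  -- towards `a₀` as `v` increases from `0`.
  set A : ℝ → ℝ := fun v => a₀ + (α₀ - a₀) * Real.exp (-v) with hA
  have hAc : Continuous A := by fun_prop
  have hApos : ∀ v, 0 < A v - a₀ := fun v => by
    simp only [hA, add_sub_cancel_left]
    exact mul_pos (sub_pos.2 h) (Real.exp_pos _)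
  have hAle : ∀ v, 0 ≤ v → A v ≤ α₀ := fun v hv => by
    have h1 : Real.exp (-v) ≤ 1 := Real.exp_le_one_iff.2 (neg_nonpos.2 hv)
    have h2 := mul_le_mul_of_nonneg_left h1 (sub_pos.2 h).le
    simp only [hA]
    linarith
  have hAmem : ∀ v, 0 ≤ v → A v ∈ Ioo (0 : ℝ) 1 := fun v hv =>
    ⟨hw.a₀_pos.trans (sub_pos.1 (hApos v)), (hAle v hv).trans_lt hα₀.2⟩
  -- The speed of `v` that yields the belief equation. Using `max v 0` extends it to negative `v`,
  -- where `A v` could leave `(0, 1)`; the solution itself stays nonnegative.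
  set η : ℝ → ℝ := fun v => M.lam * (A (max v 0) * (1 - A (max v 0)) * M.probBelow (C (A (max v 0))))
    / (A (max v 0) - a₀) with hη
  have hηc : Continuous η := by
    have hc := M.continuous_probBelow
    refine Continuous.div ?_ (by fun_prop) fun v => (hApos _).ne'
    fun_prop
  have hηpos : ∀ v, 0 < η v := fun v => by
    have hv : 0 ≤ max v 0 := le_max_right _ _
    have h1 := hAmem _ hv
    have h2 : 0 < 1 - A (max v 0) := sub_pos.2 h1.2
    have h3 : 0 < M.probBelow (C (A (max v 0))) := M.probBelow_pos
      (hw.reportCutoff_pos hΦ ⟨sub_pos.1 (hApos _), (hAle _ hv).trans_lt h'⟩)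
    exact div_pos (mul_pos hlam (mul_pos (mul_pos h1.1 h2) h3)) (hApos _)
  -- The report probability is at most `K` times the cutoff, and the cutoff at most `k * (A v -
  -- a₀)`, which cancels the denominator.
  have hηle : ∀ v, η v ≤ M.lam * (K * k) := fun v => by
    have hv : 0 ≤ max v 0 := le_max_right _ _
    have h1 := hAmem _ hv
    have h4 := hApos (max v 0)
    have h2 : 0 < C (A (max v 0)) :=
      hw.reportCutoff_pos hΦ ⟨sub_pos.1 h4, (hAle _ hv).trans_lt h'⟩
    have h3 : M.probBelow (C (A (max v 0))) ≤ K * k * (A (max v 0) - a₀) := by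
      have h5 := mul_le_mul_of_nonneg_left
        (hw.reportCutoff_le_mul M.r_pos hlam ⟨(sub_pos.1 h4).le, h1.2⟩) hK.le
      rw [mul_assoc]
      exact (hKle _ h2.le).trans h5
    rw [hη, div_le_iff₀ h4, mul_assoc M.lam (K * k)]
    refine mul_le_mul_of_nonneg_left ?_ hlam.le
    have h6 := M.probBelow_nonneg (C (A (max v 0)))
    have h7 : A (max v 0) * (1 - A (max v 0)) ≤ 1 :=
      mul_le_one₀ h1.2.le (sub_nonneg.2 h1.2.le) (by linarith [h1.1])
    calc _ ≤ 1 * M.probBelow (C (A (max v 0))) := mul_le_mul_of_nonneg_right h7 h6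
      _ ≤ _ := by linarith
  obtain ⟨v, hv0, hv⟩ := exists_global_solution_of_pos hηc hηpos hηle
  have hvmono : Monotone v := monotone_of_deriv_nonneg (fun t => (hv t).differentiableAt) fun t => by
    rw [(hv t).deriv]
    exact (hηpos _).le
  have hvnonneg : ∀ τ, 0 ≤ τ → 0 ≤ v τ := fun τ hτ => by
    rw [← hv0]
    exact hvmono hτ
  have hvc : Continuous v := continuous_iff_continuousAt.2 fun t => (hv t).continuousAt
  have hA0 : A (v 0) = α₀ := by
    simp [hA, hv0]
  have hpath := Mechanism.isBeliefPath_of_hasDerivAt (m := m) (a := fun τ => A (v τ))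
    (ξ := fun τ => M.probBelow (C (A (v τ)))) (fun τ hτ => hAmem _ (hvnonneg τ hτ))
    (M.continuous_probBelow.comp (hCc.comp (hAc.comp hvc))) (fun τ _ => hrep _) ?_
  · simp only [hA0] at hpath
    exact ⟨_, hpath⟩
  · intro τ hτ
    have h1 := (((hv τ).fun_neg.exp).const_mul (α₀ - a₀)).const_add a₀
    refine h1.congr_deriv ?_
    have h2 := (hApos (v τ)).ne'
    have h3 : (α₀ - a₀) * Real.exp (-v τ) = A (v τ) - a₀ := by
      simp only [hA, add_sub_cancel_left]
    rw [← mul_assoc, h3]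
    simp only [hη, max_eq_left (hvnonneg τ hτ)]
    field_simp

end Market

/-! ### The optimal mechanism and its four regimes -/

theorem mainTheorem3 (M : Market) :
    ∃ (m : M.Mechanism) (aSAPC aPCFC aFCNB : ℝ),
      m.IncentiveCompatible ∧ m.IsOptimal ∧
      -- the value function is differentiable and solves the planner's differential equation
      (∀ α ∈ Set.Ioo (0 : ℝ) 1, DifferentiableAt ℝ M.W α ∧
        (M.r + M.lam * α * m.reportProb α) * M.W α =
          M.lam * α * M.z * M.expect (m.p α) + (1 - M.expect (m.p α)) * M.s
            - M.expect (fun c => m.p α c * m.q α c * c)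
            + M.lam ^ 2 * M.z * α / M.r * m.reportProb α
            + (α ^ 2 - α) * M.lam * deriv M.W α * m.reportProb α) ∧
      0 < aSAPC ∧ aSAPC < aPCFC ∧ aPCFC < aFCNB ∧ aFCNB < 1 ∧
      -- Safe Arm
      (∀ α ∈ Set.Ioo 0 aSAPC, ∀ c ∈ Set.Icc 0 M.cbar, m.p α c = 0 ∧ m.q α c = 0) ∧
      -- Partial Coverage
      (∀ α ∈ Set.Ioo aSAPC aPCFC, 0 < M.C₁ α ∧ M.C₁ α < M.cbar ∧
        ∀ c ∈ Set.Icc 0 M.cbar, m.q α c = 1 ∧ m.p α c = if c < M.C₁ α then 1 else 0) ∧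
      -- Full Coverage
      (∀ α ∈ Set.Ioo aPCFC aFCNB, 0 < M.C₂ α ∧ M.C₂ α < M.cbar ∧
        ∀ c ∈ Set.Icc 0 M.cbar, m.p α c = 1 ∧ m.q α c = if c < M.C₂ α then 1 else 0) ∧
      -- Non Bonus
      (∀ α ∈ Set.Ioo aFCNB 1, ∀ c ∈ Set.Icc 0 M.cbar, m.p α c = 1 ∧ m.q α c = 0) := by
  have hr := M.r_pos
  have hlam := M.lam_pos
  have hs := M.s_pos
  have hsg := M.s_lt
  have hg : 0 < M.lam * M.z := hs.trans hsg
  obtain ⟨Φ, hΦ, hinv⟩ := M.exists_isExcessInverse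
  obtain ⟨a₀, a₁, w, w', hw⟩ := exists_isBellmanSolution hΦ hr hlam hs hsg
  set C := reportCutoff Φ M.r (M.lam * M.z) M.s w with hCdef
  have hCc : Continuous C := hw.continuous_reportCutoff hΦ
  set m := Market.cutoffMechanism M a₀ C hCc.measurable with hm
  have hHJB : ∀ α ∈ Ioo (0 : ℝ) 1, m.flowSurplus α +
      m.reportProb α * reportValue M.r M.lam (M.lam * M.z) w w' α = M.r * w α := by
    intro α hα
    rw [← hw.bellman hinv hα]
    refine Market.cutoffMechanism_flowSurplus_add hα (fun h => ?_) fun h =>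
      hw.reportCutoff_eq ⟨h.le, hα.2⟩
    -- At `a₀` itself the required inequality comes from the value equation, since the cutoff
    -- vanishes there.
    rcases h.lt_or_eq with h | h
    · exact hw.reportValue_le hr hlam hs hsg ⟨hα.1, h⟩
    · have h1 : M.lam * M.z * α ≤ M.s := by
        rw [h]
        exact hw.a₀_lt.le
      have h2 := hw.reportCutoff_eq (α := α) ⟨h.ge, hα.2⟩
      rw [hw.reportCutoff_eq_zero_of_le hΦ hr h.le, max_eq_left (sub_nonneg.2 h1)] at h2
      exact ⟨h1, by linarith⟩
  have hgreat : ∀ α₀ ∈ Ioo (0 : ℝ) 1, ∀ a, m.IsBeliefPath α₀ a →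
      IsGreatest (M.attainable α₀) (m.welfare α₀ a) := by
    intro α₀ hα₀ a ha
    refine ⟨⟨m, a, ha, rfl⟩, ?_⟩
    rintro _ ⟨n, b, hb, rfl⟩
    rw [(ha.welfare_le hw hinv hα₀).2 hHJB]
    exact (hb.welfare_le hw hinv hα₀).1
  have hpath : ∀ α₀ ∈ Ioo (0 : ℝ) 1, ∃ a, m.IsBeliefPath α₀ a := fun α₀ hα₀ =>
    Market.exists_isBeliefPath_cutoffMechanism hw hΦ hα₀
  have hW : ∀ α ∈ Ioo (0 : ℝ) 1, M.W α = w α := by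
    intro α hα
    obtain ⟨a, ha⟩ := hpath α hα
    rw [Market.W, (hgreat α hα a ha).csSup_eq, (ha.welfare_le hw hinv hα).2 hHJB]
  have hWd : ∀ α ∈ Ioo (0 : ℝ) 1, HasDerivAt M.W (w' α) α := fun α hα =>
    (hw.hasDerivAt α hα).congr_of_eventuallyEq
      (eventually_of_mem (Ioo_mem_nhds hα.1 hα.2) hW)
  have hB : ∀ α ∈ Ioo (0 : ℝ) 1, M.B α = reportValue M.r M.lam (M.lam * M.z) w w' α := by
    intro α hα
    rw [Market.B, hW α hα, (hWd α hα).deriv, reportValue]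
    ring
  have hs1 : M.s / (M.lam * M.z) < 1 := (div_lt_one hg).2 hsg
  have hlt1 : a₀ < M.s / (M.lam * M.z) := by
    rw [lt_div_iff₀ hg]
    linarith [hw.a₀_lt]
  have hlt2 : M.s / (M.lam * M.z) < a₁ := by
    rw [div_lt_iff₀ hg]
    linarith [hw.lt_a₁]
  have hq : 0 < M.lam * (M.lam * M.z - M.s) / M.r :=
    div_pos (mul_pos hlam (sub_pos.2 hsg)) hr
  -- The cutoff is at most `lam * (g - s) / r`, which the lower bound on `cbar` exceeds.
  have hCbar : ∀ α ∈ Ico a₀ 1, C α < M.cbar := by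
    intro α hα
    have h1 := hw.reportCutoff_le hr hlam hα
    have h2 := M.cbar_large
    have h3 : (M.lam / M.r + 1) * (M.lam * M.z - M.s) =
        M.lam * (M.lam * M.z - M.s) / M.r + (M.lam * M.z - M.s) := by ring
    have h4 := le_max_right (M.s - M.lam * M.z * α) 0
    have h5 : α * (M.lam * (M.lam * M.z - M.s) / M.r) ≤ 1 * (M.lam * (M.lam * M.z - M.s) / M.r) :=
      mul_le_mul_of_nonneg_right hα.2.le hq.le
    linarith
  refine ⟨m, a₀, M.s / (M.lam * M.z), a₁, Market.cutoffMechanism_incentiveCompatible,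
    fun α₀ hα₀ => ⟨hpath α₀ hα₀, hgreat α₀ hα₀⟩, fun α hα => ⟨(hWd α hα).differentiableAt, ?_⟩,
    hw.a₀_pos, hlt1, hlt2, hw.a₁_lt, fun α hα c _ => ?_, fun α hα => ?_, fun α hα => ?_,
    fun α hα c hc => ?_⟩
  · have h1 := hHJB α hα
    rw [m.flowSurplus_eq hα, reportValue] at h1
    rw [hW α hα, (hWd α hα).deriv]
    linear_combination -h1
  · simp [hm, Market.cutoffMechanism, hα.2.le]
  · have hα1 : α ∈ Ioo (0 : ℝ) 1 := ⟨hw.a₀_pos.trans hα.1, hα.2.trans hs1⟩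
    have hgα : M.lam * M.z * α < M.s := by
      have := hα.2
      rw [lt_div_iff₀ hg] at this
      linarith
    have hC1 : M.C₁ α = C α := by
      rw [Market.C₁, hB α hα1, hCdef, hw.reportCutoff_eq ⟨hα.1.le, hα1.2⟩,
        max_eq_left (by linarith)]
      ring
    rw [hC1]
    refine ⟨hw.reportCutoff_pos hΦ ⟨hα.1, hα.2.trans hlt2⟩, hCbar α ⟨hα.1.le, hα1.2⟩,
      fun c _ => ?_⟩
    by_cases hc : c < C α
    · simp [hm, Market.cutoffMechanism, not_le.2 hα.1, not_le.2 hgα, hc]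
    · simp [hm, Market.cutoffMechanism, not_le.2 hα.1, hgα, not_le.2 hgα, hc, not_lt.1 hc]
  · have hα0 : a₀ < α := hlt1.trans hα.1
    have hα1 : α ∈ Ioo (0 : ℝ) 1 := ⟨hw.a₀_pos.trans hα0, hα.2.trans hw.a₁_lt⟩
    have hgα : M.s < M.lam * M.z * α := by
      have := hα.1
      rw [div_lt_iff₀ hg] at this
      linarith
    have hC2 : M.C₂ α = C α := by
      rw [Market.C₂, hB α hα1, hCdef, hw.reportCutoff_eq ⟨hα0.le, hα1.2⟩,
        max_eq_right (by linarith), sub_zero]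
    rw [hC2]
    refine ⟨hw.reportCutoff_pos hΦ ⟨hα0, hα.2⟩, hCbar α ⟨hα0.le, hα1.2⟩, fun c _ => ?_⟩
    by_cases hc : c < C α
    · simp [hm, Market.cutoffMechanism, not_le.2 hα0, hc, not_lt.2 hgα.le]
    · simp [hm, Market.cutoffMechanism, not_le.2 hα0, not_lt.2 hgα.le, hgα.le, hc, not_lt.1 hc]
  · have hα0 : a₀ < α := (hlt1.trans hlt2).trans hα.1
    have hgα : M.s ≤ M.lam * M.z * α := by
      have h1 := mul_le_mul_of_nonneg_left hα.1.le hg.le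
      linarith [hw.lt_a₁]
    -- With a zero cutoff and the strict test `c < C α`, not even an agent with cost `0` reports.
    have hC0 : C α = 0 := hw.reportCutoff_eq_zero_of_ge hΦ hr hα.1.le
    simp [hm, Market.cutoffMechanism, not_le.2 hα0, not_lt.2 hgα, hgα, hC0, hc.1]
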